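/- Let $\mathfrak g$ be a real Lie algebra of finite dimension $2n$ equipped with an abelian complex structure $J$, i.e. a linear map $J:\mathfrak g\to\mathfrak g$ with $J^2=-\mathrm{Id}$ and $[Jx,Jy]=[x,y]$ for all $x,y\in\mathfrak g$ (such a $J$ is automatically integrable). Call a complex-valued alternating real-multilinear $n$-form $\sigma$ on $\mathfrak g$ an $(n,0)$-form if $\sigma(v_1,\dots,Jv_i,\dots,v_n)=\sqrt{-1}\,\sigma(v_1,\dots,v_n)$ for every $i$, and closed if its Chevalley--Eilenberg differential $d\sigma$ vanishes. Then $(\mathfrak g,J)$ has a nonzero closed $(n,0)$-form if and only if $\mathfrak g$ is unimodular, i.e. $\operatorname{Tr}(\operatorname{ad}x)=0$ for all $x\in\mathfrak g$. In particular, let $G$ be a simply connected solvable real Lie group of dimension $2n$, let $\Gamma\subset G$ be a discrete subgroup with $\Gamma\backslash G$ compact, and equip the solvmanifold $\Gamma\backslash G$ with the complex structure induced by a left invariant complex structure on $G$ whose restriction $J$ to the Lie algebra of $G$ is abelian. Then the canonical bundle of the complex manifold $\Gamma\backslash G$ is holomorphically trivial, i.e. there is a nowhere vanishing holomorphic $(n,0)$-form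 on $\Gamma\backslash G$. -/

import Mathlib

open scoped Manifold ContDiff Topology

noncomputable section

/-! ### Complex-valued forms on real Lie algebras -/

section LieAlgebra

/-- A complex-valued real-multilinear `k`-form `σ` on a real vector space with complex structure
`J` has type `(k, 0)`: `σ(v₁, …, J vᵢ, …, vₖ) = i σ(v₁, …, vₖ)` for every slot. -/
def IsTypeKZero {V : Type*} (J : V → V) {k : ℕ} (σ : (Fin k → V) → ℂ) : Prop :=
  ∀ (v : Fin k → V) (i : Fin k), σ (Function.update v i (J (v i))) = Complex.I * σ v

/-- An abelian complex structure on a real Lie algebra: `J² = -1` and `[Jx, Jy] = [x, y]`. -/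
structure IsAbelianComplexStructure {𝔤 : Type*} [LieRing 𝔤] [LieAlgebra ℝ 𝔤]
    (J : 𝔤 →ₗ[ℝ] 𝔤) : Prop where
  sq_eq_neg : ∀ x, J (J x) = -x
  lie_map_map : ∀ x y, ⁅J x, J y⁆ = ⁅x, y⁆

/-- An abelian complex structure is integrable: its Nijenhuis tensor vanishes. -/
theorem IsAbelianComplexStructure.nijenhuis_eq_zero {𝔤 : Type*} [LieRing 𝔤] [LieAlgebra ℝ 𝔤]
    {J : 𝔤 →ₗ[ℝ] 𝔤} (hJ : IsAbelianComplexStructure J) (x y : 𝔤) :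
    ⁅x, y⁆ + J (⁅J x, y⁆ + ⁅x, J y⁆) - ⁅J x, J y⁆ = 0 := by
  have h : ⁅J x, y⁆ + ⁅x, J y⁆ = 0 := by
    rw [← hJ.lie_map_map x (J y), hJ.sq_eq_neg, lie_neg, add_neg_cancel]
  rw [h, map_zero, hJ.lie_map_map, add_zero, sub_self]

/-- The Chevalley-Eilenberg differential of a complex-valued `k`-form on a real Lie algebra,
`dσ(x₀, …, xₖ) = ∑_{i < j} (-1)^(i+j) σ([xᵢ, xⱼ], x₀, …, x̂ᵢ, …, x̂ⱼ, …, xₖ)`.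
The bracket is written in the slot of `xᵢ`, where `xᵢ` stood; moving it there from the first slot
contributes `(-1)^i`, so that the sign is `(-1)^j`. -/
def lieFormDifferential {𝔤 : Type*} [LieRing 𝔤] [LieAlgebra ℝ 𝔤] {k : ℕ}
    (σ : 𝔤 [⋀^Fin k]→ₗ[ℝ] ℂ) (x : Fin (k + 1) → 𝔤) : ℂ :=
  ∑ j : Fin (k + 1), ∑ i ∈ Finset.Iio j,
    (-1 : ℂ) ^ (j : ℕ) * σ (j.removeNth (Function.update x i ⁅x i, x j⁆))

/-- A Lie algebra is unimodular if `tr (ad x) = 0` for all `x`. -/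
def IsUnimodularLieAlgebra (𝔤 : Type*) [LieRing 𝔤] [LieAlgebra ℝ 𝔤] : Prop :=
  ∀ x : 𝔤, LinearMap.trace ℝ 𝔤 (LieAlgebra.ad ℝ 𝔤 x) = 0

end LieAlgebra

/-! ### Differential forms and the canonical bundle -/

section Forms

variable (E : Type*) [NormedAddCommGroup E] [NormedSpace ℝ E]
  (M : Type*) [TopologicalSpace M] [ChartedSpace E M]

/-- Complex-valued differential `k`-forms on a manifold `M` modelled on `E` (no smoothness). -/
abbrev ComplexForm (k : ℕ) : Type _ :=
  ∀ x : M, TangentSpace 𝓘(ℝ, E) x [⋀^Fin k]→L[ℝ] ℂ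

variable {E M} {k : ℕ}

/-- The expression of a form in the preferred chart at `x₀`: its pullback by the inverse chart. -/
def ComplexForm.inChart (σ : ComplexForm E M k) (x₀ : M) (y : E) : E [⋀^Fin k]→L[ℝ] ℂ :=
  (σ ((extChartAt 𝓘(ℝ, E) x₀).symm y)).compContinuousLinearMap
    (mfderiv 𝓘(ℝ, E) 𝓘(ℝ, E) (extChartAt 𝓘(ℝ, E) x₀).symm y)

/-- A form is smooth if its expressions in the charts are smooth. -/
def ComplexForm.IsSmooth (σ : ComplexForm E M k) : Prop :=
  ∀ x₀ : M, ContDiffOn ℝ ∞ (σ.inChart x₀) (extChartAt 𝓘(ℝ, E) x₀).target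

/-- The exterior derivative of a form, computed at each point in the chart at that point. -/
def ComplexForm.d (σ : ComplexForm E M k) : ComplexForm E M (k + 1) := fun x ↦
  (extDeriv (σ.inChart x) (extChartAt 𝓘(ℝ, E) x x)).compContinuousLinearMap
    (mfderiv 𝓘(ℝ, E) 𝓘(ℝ, E) (extChartAt 𝓘(ℝ, E) x) x)

variable (J : ∀ x : M, TangentSpace 𝓘(ℝ, E) x →L[ℝ] TangentSpace 𝓘(ℝ, E) x)

/-- `σ` has type `(k, 0)` with respect to the complex structure `J`. -/
def ComplexForm.HasTypeKZero (σ : ComplexForm E M k) : Prop :=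
  ∀ x, IsTypeKZero (J x) (σ x)

/-- A holomorphic `(k, 0)`-form on the complex manifold `(M, J)`: a smooth form `σ` of type
`(k, 0)` with `∂̄σ = 0`. Since `dσ = ∂σ + ∂̄σ` with `∂σ` the part of type `(k + 1, 0)`, the equation
`∂̄σ = 0` says that `dσ` has type `(k + 1, 0)`. -/
structure ComplexForm.IsHolomorphic (σ : ComplexForm E M k) : Prop where
  isSmooth : σ.IsSmooth
  hasType : σ.HasTypeKZero J
  dbar_eq_zero : σ.d.HasTypeKZero J

/-- The canonical bundle of a complex manifold `(M, J)` of complex dimension `n` is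
holomorphically trivial: there is a nowhere vanishing holomorphic `(n, 0)`-form. -/
def HasTrivialCanonicalBundle (n : ℕ) : Prop :=
  ∃ σ : ComplexForm E M n, σ.IsHolomorphic J ∧ ∀ x, σ x ≠ 0

end Forms

/-! ### Quotients of Lie groups by discrete subgroups -/

section Quotient

instance minSmoothness_real_three_leInfty : ENat.LEInfty (minSmoothness ℝ 3) :=
  ⟨by rw [minSmoothness_of_isRCLikeNormedField]; exact ENat.LEInfty.out⟩

/-- The quotient `Γ\G` of `G` by left multiplication by elements of `Γ`. -/
abbrev LeftQuotient {G : Type*} [Group G] (Γ : Subgroup G) : Type _ :=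
  MulAction.orbitRel.Quotient Γ G

/-- The canonical projection `G → Γ\G`. -/
def LeftQuotient.mk {G : Type*} [Group G] (Γ : Subgroup G) : G → LeftQuotient Γ :=
  Quotient.mk (MulAction.orbitRel Γ G)

theorem LeftQuotient.mk_eq_mk_iff {G : Type*} [Group G] {Γ : Subgroup G} {g h : G} :
    LeftQuotient.mk Γ g = LeftQuotient.mk Γ h ↔ ∃ γ ∈ Γ, γ * h = g := by
  rw [LeftQuotient.mk, Quotient.eq, MulAction.orbitRel_apply]
  constructor
  · rintro ⟨γ, rfl⟩
    exact ⟨γ, γ.2, rfl⟩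
  · rintro ⟨γ, hγ, rfl⟩
    exact ⟨⟨γ, hγ⟩, rfl⟩

theorem LeftQuotient.mk_surjective {G : Type*} [Group G] (Γ : Subgroup G) :
    Function.Surjective (LeftQuotient.mk Γ) := Quotient.mk_surjective

/-- For `Γ` discrete the projection `G → Γ\G` is a local homeomorphism. -/
theorem LeftQuotient.isLocalHomeomorph_mk
    (E : Type*) [NormedAddCommGroup E] [NormedSpace ℝ E] [FiniteDimensional ℝ E]
    {G : Type*} [TopologicalSpace G] [T2Space G] [ChartedSpace E G] [Group G]
    [LieGroup 𝓘(ℝ, E) ∞ G] (Γ : Subgroup G) [DiscreteTopology Γ] :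
    IsLocalHomeomorph (LeftQuotient.mk Γ) := by
  have : IsTopologicalGroup G := topologicalGroup_of_lieGroup 𝓘(ℝ, E) ∞
  have : LocallyCompactSpace G := Manifold.locallyCompact_of_finiteDimensional 𝓘(ℝ, E)
  have : ProperlyDiscontinuousSMul Γ G :=
    Γ.properlyDiscontinuousSMul_of_tendsto_cofinite
      (Γ.tendsto_coe_cofinite_of_discrete (isDiscrete_iff_discreteTopology.mpr inferInstance))
  exact isQuotientCoveringMap_quotientMk_of_properlyDiscontinuousSMul.isCoveringMap.isLocalHomeomorph

variable {E : Type*} [NormedAddCommGroup E] [NormedSpace ℝ E] [FiniteDimensional ℝ E]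
  {G : Type*} [TopologicalSpace G] [T2Space G] [ChartedSpace E G] [Group G]
  [LieGroup 𝓘(ℝ, E) ∞ G]

/-- The charts of `Γ\G`: local inverses of the projection followed by charts of `G`. -/
instance LeftQuotient.chartedSpace (Γ : Subgroup G) [DiscreteTopology Γ] :
    ChartedSpace E (LeftQuotient Γ) :=
  (LeftQuotient.isLocalHomeomorph_mk E Γ).chartedSpace (LeftQuotient.mk_surjective Γ)

variable (Γ : Subgroup G) [DiscreteTopology Γ]

variable (E) in
/-- A local inverse of the projection composed with the projection is locally a left translation
by an element of `Γ`. -/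
theorem LeftQuotient.localInverse_mk_eventuallyEq (g a : G)
    (ha : LeftQuotient.mk Γ a ∈ ((LeftQuotient.isLocalHomeomorph_mk E Γ).localInverseAt g).source) :
    ∃ γ : G, (fun x ↦ (LeftQuotient.isLocalHomeomorph_mk E Γ).localInverseAt g
      (LeftQuotient.mk Γ x)) =ᶠ[𝓝 a] fun x ↦ γ * x := by
  have : IsTopologicalGroup G := topologicalGroup_of_lieGroup 𝓘(ℝ, E) ∞
  set h := LeftQuotient.isLocalHomeomorph_mk E Γ
  have hc := h.continuous
  have h1 := h.apply_localInverseAt_of_mem ha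
  obtain ⟨γ, hγ, hab⟩ := LeftQuotient.mk_eq_mk_iff.1 h1
  refine ⟨γ, ?_⟩
  have e1 : ∀ᶠ x in 𝓝 a, LeftQuotient.mk Γ x ∈ (h.localInverseAt g).source :=
    hc.continuousAt.eventually_mem ((h.localInverseAt g).open_source.mem_nhds ha)
  have e2 : ∀ᶠ x in 𝓝 a, γ * x ∈ (h.localInverseAt g).target := by
    refine (continuous_const_mul γ).continuousAt.eventually_mem
      ((h.localInverseAt g).open_target.mem_nhds ?_)
    rw [hab]
    exact (h.localInverseAt g).map_source ha
  filter_upwards [e1, e2] with x hx1 hx2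
  apply h.injOn_localInverseAt_target ((h.localInverseAt g).map_source hx1) hx2
  rw [h.apply_localInverseAt_of_mem hx1]
  exact (LeftQuotient.mk_eq_mk_iff.2 ⟨γ, hγ, rfl⟩).symm

theorem LeftQuotient.contMDiffAt_localInverse_mk (g a : G)
    (ha : LeftQuotient.mk Γ a ∈ ((LeftQuotient.isLocalHomeomorph_mk E Γ).localInverseAt g).source) :
    ContMDiffAt 𝓘(ℝ, E) 𝓘(ℝ, E) ∞ (fun x ↦ (LeftQuotient.isLocalHomeomorph_mk E Γ).localInverseAt g
      (LeftQuotient.mk Γ x)) a := by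
  obtain ⟨γ, h⟩ := LeftQuotient.localInverse_mk_eventuallyEq E Γ g a ha
  exact (contMDiff_mul_left (a := γ)).contMDiffAt.congr_of_eventuallyEq h

instance LeftQuotient.isManifold : IsManifold 𝓘(ℝ, E) ∞ (LeftQuotient Γ) := by
  apply isManifold_of_contDiffOn
  rintro _ _ ⟨q, rfl⟩ ⟨q', rfl⟩
  set h := LeftQuotient.isLocalHomeomorph_mk E Γ
  set r := Classical.choose (LeftQuotient.mk_surjective Γ).hasRightInverse
  simp only [modelWithCornersSelf_coe, modelWithCornersSelf_coe_symm, Function.comp_id,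
    Function.id_comp, Set.preimage_id, Set.range_id, Set.inter_univ]
  rw [← contMDiffOn_iff_contDiffOn]
  intro y hy
  apply ContMDiffAt.contMDiffWithinAt
  simp only [OpenPartialHomeomorph.trans_source, OpenPartialHomeomorph.symm_source,
    OpenPartialHomeomorph.trans_target, OpenPartialHomeomorph.coe_trans, Function.comp_apply,
    OpenPartialHomeomorph.coe_trans_symm, Set.mem_inter_iff, Set.mem_preimage] at hy ⊢
  obtain ⟨⟨hy1, -⟩, hy2, hy3⟩ := hy
  rw [IsLocalHomeomorph.localInverseAt_symm] at hy2 hy3 ⊢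
  have A := LeftQuotient.contMDiffAt_localInverse_mk (E := E) Γ _ _ hy2
  have B := (contMDiffOn_chart (I := 𝓘(ℝ, E)) (n := ∞)).contMDiffAt
    ((chartAt E _).open_source.mem_nhds hy3)
  have C := (contMDiffOn_chart_symm (I := 𝓘(ℝ, E)) (n := ∞)).contMDiffAt
    ((chartAt E _).open_target.mem_nhds hy1)
  have D := ContMDiffAt.comp _ (f := fun x ↦ (LeftQuotient.isLocalHomeomorph_mk E Γ).localInverseAt _
    (LeftQuotient.mk Γ x)) B A
  exact D.comp _ C

/-- The projection `G → Γ\G` is a local diffeomorphism. -/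
theorem LeftQuotient.isLocalDiffeomorph_mk :
    IsLocalDiffeomorph 𝓘(ℝ, E) 𝓘(ℝ, E) ∞ (LeftQuotient.mk Γ) := by
  intro a
  set h := LeftQuotient.isLocalHomeomorph_mk E Γ with hh
  refine ⟨⟨(h.localInverseAt a).symm.toPartialEquiv, (h.localInverseAt a).symm.open_source,
    (h.localInverseAt a).symm.open_target, ?_, ?_⟩, h.self_mem_localInverseAt_target, fun x _ ↦ ?_⟩
  · intro x _
    apply ContMDiffAt.contMDiffWithinAt
    change ContMDiffAt _ _ _ (h.localInverseAt a).symm x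
    rw [h.localInverseAt_symm, contMDiffAt_iff_target]
    refine ⟨h.continuous.continuousAt, ?_⟩
    have hx := mem_chart_source E (LeftQuotient.mk Γ x)
    have A := LeftQuotient.contMDiffAt_localInverse_mk (E := E) Γ _ x hx.1
    have B := (contMDiffOn_chart (I := 𝓘(ℝ, E)) (n := ∞)).contMDiffAt
      ((chartAt E _).open_source.mem_nhds hx.2)
    exact ContMDiffAt.comp _ (f := fun x ↦ (LeftQuotient.isLocalHomeomorph_mk E Γ).localInverseAt _
      (LeftQuotient.mk Γ x)) B A
  · intro x hx
    apply ContMDiffAt.contMDiffWithinAt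
    change ContMDiffAt _ _ _ (h.localInverseAt a) x
    rw [contMDiffAt_iff_source]
    simp only [modelWithCornersSelf_coe, Set.range_id, contMDiffWithinAt_univ]
    have hy := mem_chart_target E x
    have hx' := (chartAt E x).left_inv (mem_chart_source E x)
    have e : ((chartAt E x).symm : E → LeftQuotient Γ) = LeftQuotient.mk Γ ∘
        (chartAt E (Classical.choose (LeftQuotient.mk_surjective Γ).hasRightInverse x)).symm := by
      funext z
      exact congrFun (h.localInverseAt_symm
        (x := Classical.choose (LeftQuotient.mk_surjective Γ).hasRightInverse x)) _
    have C := (contMDiffOn_chart_symm (I := 𝓘(ℝ, E)) (n := ∞)).contMDiffAt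
      ((chartAt E _).open_target.mem_nhds hy.1)
    rw [e] at hx'
    have A := LeftQuotient.contMDiffAt_localInverse_mk (E := E) Γ a _ (hx'.symm ▸ hx)
    have D := A.comp _ C
    have e' : ((extChartAt 𝓘(ℝ, E) x).symm : E → LeftQuotient Γ) = (chartAt E x).symm := by
      ext; simp
    have e'' : extChartAt 𝓘(ℝ, E) x x = chartAt E x x := by simp
    rw [e', e'', e]
    exact D
  · change _ = (h.localInverseAt a).symm x
    rw [h.localInverseAt_symm]

/-- The almost complex structure `JM` on `Γ\G` is induced by the left invariant one on `G` which is
given by the endomorphism `J` of the Lie algebra of `G`: for `v` in the Lie algebra with left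
invariant vector field `X_v`, the differential of the projection sends `X_{Jv}` to the `JM`-image
of what it sends `X_v` to. -/
def LeftQuotient.IsInducedComplexStructure
    (J : GroupLieAlgebra 𝓘(ℝ, E) G →ₗ[ℝ] GroupLieAlgebra 𝓘(ℝ, E) G)
    (JM : ∀ x : LeftQuotient Γ, TangentSpace 𝓘(ℝ, E) x →L[ℝ] TangentSpace 𝓘(ℝ, E) x) : Prop :=
  ∀ (g : G) (v : GroupLieAlgebra 𝓘(ℝ, E) G),
    JM (LeftQuotient.mk Γ g) (mfderiv 𝓘(ℝ, E) 𝓘(ℝ, E) (LeftQuotient.mk Γ) g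
      (mulInvariantVectorField v g)) =
    mfderiv 𝓘(ℝ, E) 𝓘(ℝ, E) (LeftQuotient.mk Γ) g (mulInvariantVectorField (J v) g)

/-- The differential at `1` of `h ↦ Γgh`, as an endomorphism of the model space, is the
composition of the differentials of the left translation by `g` and of the projection, and is
invertible. -/
theorem LeftQuotient.mfderiv_mk_mulInvariantVectorField (g : G) :
    ∃ P : E ≃L[ℝ] E, (P : E →L[ℝ] E) =
        (mfderiv 𝓘(ℝ, E) 𝓘(ℝ, E) (fun h ↦ LeftQuotient.mk Γ (g * h)) (1 : G) : E →L[ℝ] E) ∧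
      ∀ v : GroupLieAlgebra 𝓘(ℝ, E) G, (mfderiv 𝓘(ℝ, E) 𝓘(ℝ, E) (LeftQuotient.mk Γ) g
        (mulInvariantVectorField v g) : E) = P v := by
  have hL : IsLocalDiffeomorph 𝓘(ℝ, E) 𝓘(ℝ, E) ∞ (fun h : G ↦ g * h) :=
    Diffeomorph.isLocalDiffeomorph (Φ := ⟨Equiv.mulLeft g, contMDiff_mul_left, contMDiff_mul_left⟩)
  have hπ := LeftQuotient.isLocalDiffeomorph_mk (E := E) Γ
  have hP : IsLocalDiffeomorphAt 𝓘(ℝ, E) 𝓘(ℝ, E) ∞ (fun h ↦ LeftQuotient.mk Γ (g * h)) (1 : G) :=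
    (hL 1).comp 𝓘(ℝ, E) _ (hπ _)
  have hn : (∞ : ℕ∞ω) ≠ 0 := by simp
  refine ⟨hP.mfderivToContinuousLinearEquiv hn, hP.mfderivToContinuousLinearEquiv_coe hn, ?_⟩
  intro v
  have e := mfderiv_comp_apply (I := 𝓘(ℝ, E)) (I' := 𝓘(ℝ, E)) (I'' := 𝓘(ℝ, E))
    (f := fun h : G ↦ g * h) (g := LeftQuotient.mk Γ) 1
    ((hπ _).mdifferentiableAt hn) ((hL 1).mdifferentiableAt hn) v
  have e2 := congrArg (fun f : E →L[ℝ] E ↦ f v) (hP.mfderivToContinuousLinearEquiv_coe hn)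
  refine Eq.trans ?_ (e.symm.trans e2.symm)
  rw [mul_one]
  rfl

/-- Every endomorphism of the Lie algebra of `G` induces exactly one field of endomorphisms of the
tangent spaces of `Γ\G`. -/
theorem LeftQuotient.existsUnique_isInducedComplexStructure
    (J : GroupLieAlgebra 𝓘(ℝ, E) G →ₗ[ℝ] GroupLieAlgebra 𝓘(ℝ, E) G) :
    ∃! JM : ∀ x : LeftQuotient Γ, TangentSpace 𝓘(ℝ, E) x →L[ℝ] TangentSpace 𝓘(ℝ, E) x,
      LeftQuotient.IsInducedComplexStructure Γ J JM := by
  choose P hP hPv using LeftQuotient.mfderiv_mk_mulInvariantVectorField (E := E) Γ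
  choose r hr using LeftQuotient.mk_surjective Γ
  have hrP (g : G) : P (r (LeftQuotient.mk Γ g)) = P g := by
    obtain ⟨γ, hγ, e⟩ := LeftQuotient.mk_eq_mk_iff.1 (hr (LeftQuotient.mk Γ g))
    apply ContinuousLinearEquiv.coe_injective
    rw [hP, hP]
    have : (fun h ↦ LeftQuotient.mk Γ (r (LeftQuotient.mk Γ g) * h)) =
        fun h ↦ LeftQuotient.mk Γ (g * h) := by
      funext h
      exact LeftQuotient.mk_eq_mk_iff.2 ⟨γ, hγ, by rw [← e, mul_assoc]⟩
    rw [this]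
  let J' : E →L[ℝ] E := LinearMap.toContinuousLinearMap (E := E) (F' := E) J
  refine ⟨fun x ↦ ((P (r x) : E →L[ℝ] E).comp J').comp ((P (r x)).symm : E →L[ℝ] E), ?_, ?_⟩
  · intro g v
    have e1 := hPv g v
    have e2 := hPv g (J v)
    refine Eq.trans ?_ e2.symm
    change P (r (LeftQuotient.mk Γ g)) (J' ((P (r (LeftQuotient.mk Γ g))).symm _)) = _
    rw [hrP]
    refine congrArg (fun w ↦ P g (J' w)) ?_
    exact (P g).symm_apply_eq.2 e1
  · intro JM hJM
    funext x
    obtain ⟨g, rfl⟩ := LeftQuotient.mk_surjective Γ x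
    ext w
    have e1 := (hPv g ((P g).symm w)).trans ((P g).apply_symm_apply w)
    have e2 := hPv g (J ((P g).symm w))
    have e3 := (hJM g ((P g).symm w)).trans e2
    refine (congrArg (JM (LeftQuotient.mk Γ g)) e1.symm).trans (e3.trans ?_)
    change _ = P (r (LeftQuotient.mk Γ g)) (J' ((P (r (LeftQuotient.mk Γ g))).symm w))
    rw [hrP]
    rfl

end Quotient

end

/-! ### Alternating forms: the trace identity and a sign rule -/

section AlternatingForms

/-! Algebraic part. Regard 𝔤 as a complex vector space through `J`, and let A_x be the complex
linear part of ad x. Since `J` is abelian, [Jx, y] = -[x, Jy], and this yields two facts: A_x y -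
A_y x = [x, y], and A_x is conjugate linear in x. Putting the first into dσ, for σ of type (n, 0),
the terms that share x_i assemble into a trace because σ is a top-degree complex form, so dσ(x₀, …,
x_n) = -∑ (-1)^i tr(A_{x_i}) σ(…, x̂_i, …) (`lieFormDifferential_eq_sum_trace`). Hence dσ = 0 if tr
A_x = 0 for all x. Conversely, evaluating at (i b_k, b₁, …, b_n) for a complex basis b gives a
nonzero multiple of tr(A_{b_k}) σ(b). Finally tr_ℝ(ad x) = 2 Re tr_ℂ(A_x), and replacing x by ix
recovers the imaginary part, so vanishing of tr A is unimodularity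
(`trace_complexLinearAd_eq_zero_iff`).

Geometric part. A closed invariant form descends to Γ\G. It is smooth, nowhere zero and of type (n,
0), and it is closed because on left invariant fields the exterior derivative is the
Chevalley-Eilenberg differential (`extDeriv_apply_eq_lieFormDifferential`). What remains is
unimodularity of the Lie algebra of G. A fundamental domain for Γ of finite measure stays one after
right translation, so Haar measure is bi-invariant
(`LeftQuotient.isMulRightInvariant_of_compactSpace`).

The passage from the measure to the Lie algebra is by integration by parts. The left invariant field
of v is ∑ a_i R_i, where R_i are the right invariant fields of a basis and a_i(g) are the
coordinates of Ad(g)v. Bi-invariance kills the integrals of derivatives of test functions along both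
kinds of field, so ∑ R_i a_i integrates to zero against every test function and vanishes. Its value
at 1 is -tr(ad v), because the derivative of Ad at 1 is ad (`derivAtOne_lieGroupAd`). -/

theorem AlternatingMap.sum_map_update_eq_trace_smul {K V W ι : Type*} [Field K]
    [AddCommGroup V] [Module K V] [AddCommGroup W] [Module K W] [Fintype ι] [DecidableEq ι]
    (b : Module.Basis ι K V) (f : V [⋀^ι]→ₗ[K] W) (A : V →ₗ[K] V) (v : ι → V) :
    ∑ j, f (Function.update v j (A (v j))) = LinearMap.trace K V A • f v := by
  let g : MultilinearMap K (fun _ : ι ↦ V) W := ∑ j,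
    f.toMultilinearMap.compLinearMap fun i ↦ if i = j then A else LinearMap.id
  have hg (v : ι → V) : g v = ∑ j, f (Function.update v j (A (v j))) := by
    simp only [g, sum_apply, MultilinearMap.compLinearMap_apply]
    refine Finset.sum_congr rfl fun j _ ↦ congrArg f (funext fun i ↦ ?_)
    by_cases h : i = j
    · subst h; simp
    · simp [h]
  suffices H : g = LinearMap.trace K V A • f.toMultilinearMap by
    rw [← hg, H]; rfl
  -- Both sides are multilinear, so tuples of basis vectors suffice. For a permutation of the basis,
  -- slot `j` contributes a diagonal entry of `A`. For a tuple that repeats at `p` and `q`, those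
  -- two slots cancel and all others vanish.
  refine Module.Basis.ext_multilinear (fun _ ↦ b) fun s ↦ ?_
  rw [hg]
  change _ = LinearMap.trace K V A • f fun i ↦ b (s i)
  by_cases hs : Function.Injective s
  · have hs' : Function.Bijective s := Finite.injective_iff_bijective.1 hs
    have key (j : ι) : f (Function.update (fun i ↦ b (s i)) j (A (b (s j)))) =
        b.repr (A (b (s j))) (s j) • f fun i ↦ b (s i) := by
      conv_lhs => rw [← b.sum_repr (A (b (s j)))]
      rw [AlternatingMap.map_update_sum, Finset.sum_eq_single (s j)]
      · rw [AlternatingMap.map_update_smul]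
        congr 2
        exact Function.update_eq_self j fun i ↦ b (s i)
      · intro k _ hk
        obtain ⟨l, rfl⟩ := hs'.2 k
        have hlj : l ≠ j := fun h ↦ hk (congrArg s h)
        rw [AlternatingMap.map_update_smul, AlternatingMap.map_update_self _ _ hlj.symm, smul_zero]
      · simp
    simp only [key]
    rw [← Finset.sum_smul, LinearMap.trace_eq_matrix_trace K b, Matrix.trace]
    congr 1
    simp only [Matrix.diag, LinearMap.toMatrix_apply]
    exact (Equiv.ofBijective s hs').sum_comp fun i ↦ b.repr (A (b i)) i
  · obtain ⟨p, q, hpq, hne⟩ : ∃ p q, s p = s q ∧ p ≠ q := by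
      simpa [Function.Injective] using hs
    rw [f.map_eq_zero_of_eq (fun i ↦ b (s i)) (congrArg b hpq) hne, smul_zero]
    rw [Finset.sum_eq_add p q hne]
    · rw [← hpq]
      set w := A (b (s p))
      have := f.map_swap (v := Function.update (fun i ↦ b (s i)) p w) hne
      rw [← eq_neg_iff_add_eq_zero, ← neg_eq_iff_eq_neg, ← this]
      congr 1
      funext i
      simp only [Function.comp_apply, Function.update_apply, Equiv.swap_apply_def]
      split_ifs <;> simp_all
    · intro j _ hj
      refine f.map_eq_zero_of_eq _ (i := p) (j := q) ?_ hne
      rw [Function.update_of_ne hj.1.symm, Function.update_of_ne hj.2.symm, hpq]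
    · simp
    · simp

/-- With `w` in both slots the tuple has a repeated entry, and deleting one copy or the other
changes the value only by the sign of a cyclic permutation. -/
theorem AlternatingMap.neg_one_pow_smul_map_removeNth_update {R M N : Type*} [CommRing R]
    [AddCommGroup M] [AddCommGroup N] [Module R M] [Module R N] {n : ℕ} (f : M [⋀^Fin n]→ₗ[R] N)
    (v : Fin (n + 1) → M) {i j : Fin (n + 1)} (hij : i ≠ j) (w : M) :
    (-1 : ℤ) ^ (j : ℕ) • f (j.removeNth (Function.update v i w)) =
      -((-1 : ℤ) ^ (i : ℕ) • f (i.removeNth (Function.update v j w))) := by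
  rw [eq_neg_iff_add_eq_zero, add_comm]
  have h := f.neg_one_pow_smul_map_removeNth_add_eq_zero_of_eq
    (v := Function.update (Function.update v i w) j w) (i := i) (j := j) (by simp [hij]) hij
  rw [Fin.removeNth_update] at h
  rw [Function.update_comm hij, Fin.removeNth_update] at h
  exact h

end AlternatingForms

/-- In the real basis b_k, i b_k each complex diagonal entry contributes its real part twice. -/
theorem LinearMap.trace_restrictScalars_complex {V : Type*} [AddCommGroup V] [Module ℝ V]
    [Module ℂ V] [IsScalarTower ℝ ℂ V] [FiniteDimensional ℂ V] (f : V →ₗ[ℂ] V) :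
    LinearMap.trace ℝ V (f.restrictScalars ℝ) = 2 * (LinearMap.trace ℂ V f).re := by
  classical
  let b := Module.finBasis ℂ V
  rw [LinearMap.trace_eq_matrix_trace ℂ b, LinearMap.trace_eq_matrix_trace ℝ
    (Complex.basisOneI.smulTower b)]
  simp only [Matrix.trace, Matrix.diag, LinearMap.toMatrix_apply, Fintype.sum_prod_type,
    Fin.sum_univ_two, Module.Basis.smulTower_repr_mk, Module.Basis.smulTower_apply,
    LinearMap.restrictScalars_apply, map_smul, Finsupp.smul_apply, Complex.re_sum]
  simp [Finset.mul_sum, ← Finset.sum_add_distrib, two_mul, Complex.basisOneI]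

/-! ### The complex linear part of ad and its trace -/

section AbelianComplexStructure

variable {𝔤 : Type*} [LieRing 𝔤] [LieAlgebra ℝ 𝔤] [Module ℂ 𝔤] [IsScalarTower ℝ ℂ 𝔤]

/-- The complex linear part of `ad x`. -/
noncomputable def complexLinearAd (x : 𝔤) : 𝔤 →ₗ[ℂ] 𝔤 where
  toFun y := (2⁻¹ : ℝ) • (⁅x, y⁆ - Complex.I • ⁅x, Complex.I • y⁆)
  map_add' y z := by simp only [smul_add, lie_add]; module
  map_smul' c y := by
    have hc (z : 𝔤) : c • z = c.re • z + c.im • Complex.I • z := by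
      have hr (r : ℝ) (z : 𝔤) : (r : ℂ) • z = r • z := algebraMap_smul ℂ r z
      conv_lhs => rw [← Complex.re_add_im c, add_smul, mul_smul, hr, hr]
    have hI (z : 𝔤) : Complex.I • Complex.I • z = -z := by
      rw [← mul_smul, Complex.I_mul_I, neg_one_smul]
    have hcomm (r : ℝ) (z : 𝔤) : Complex.I • r • z = r • Complex.I • z := smul_comm _ _ _
    simp only [RingHom.id_apply, hc, smul_add, smul_sub, lie_add, lie_smul, hcomm, hI, lie_neg]
    module

theorem complexLinearAd_apply (x y : 𝔤) :
    complexLinearAd x y = (2⁻¹ : ℝ) • (⁅x, y⁆ - Complex.I • ⁅x, Complex.I • y⁆) := rfl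

theorem I_smul_lie {𝔤 : Type*} [LieRing 𝔤] [Module ℂ 𝔤]
    (hlie : ∀ x y : 𝔤, ⁅Complex.I • x, Complex.I • y⁆ = ⁅x, y⁆) (x y : 𝔤) :
    ⁅Complex.I • x, y⁆ = -⁅x, Complex.I • y⁆ := by
  rw [← hlie x, ← mul_smul, Complex.I_mul_I, neg_one_smul, lie_neg, neg_neg]

/-- The terms containing `I` cancel by `I_smul_lie`. This trades the bracket, which is not complex
bilinear, for complex linear operators whose traces make sense. -/
theorem complexLinearAd_sub_complexLinearAd
    (hlie : ∀ x y : 𝔤, ⁅Complex.I • x, Complex.I • y⁆ = ⁅x, y⁆) (x y : 𝔤) :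
    complexLinearAd x y - complexLinearAd y x = ⁅x, y⁆ := by
  rw [complexLinearAd_apply, complexLinearAd_apply, ← lie_skew y x, ← lie_skew y (Complex.I • x),
    I_smul_lie hlie x y]
  module

theorem complexLinearAd_I_smul
    (hlie : ∀ x y : 𝔤, ⁅Complex.I • x, Complex.I • y⁆ = ⁅x, y⁆) (x : 𝔤) :
    complexLinearAd (Complex.I • x) = -Complex.I • complexLinearAd x := by
  ext y
  rw [LinearMap.smul_apply, complexLinearAd_apply, complexLinearAd_apply, I_smul_lie hlie x y, hlie,
    smul_comm (-Complex.I) (2⁻¹ : ℝ)]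
  have hI (z : 𝔤) : Complex.I • Complex.I • z = -z := by
    rw [← mul_smul, Complex.I_mul_I, neg_one_smul]
  simp only [smul_sub, smul_neg, neg_smul, hI]
  module

/-- By cyclicity of the trace and J² = -1, the operators ad x and -J (ad x) J have the same real
trace, so averaging them preserves it. -/
theorem two_mul_re_trace_complexLinearAd [FiniteDimensional ℂ 𝔤] (x : 𝔤) :
    2 * (LinearMap.trace ℂ 𝔤 (complexLinearAd x)).re =
      LinearMap.trace ℝ 𝔤 (LieAlgebra.ad ℝ 𝔤 x) := by
  have : FiniteDimensional ℝ 𝔤 := FiniteDimensional.trans ℝ ℂ 𝔤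
  rw [← LinearMap.trace_restrictScalars_complex]
  let J : 𝔤 →ₗ[ℝ] 𝔤 := (Complex.I • (LinearMap.id : 𝔤 →ₗ[ℂ] 𝔤)).restrictScalars ℝ
  have hJ : J ∘ₗ J = -LinearMap.id := by
    ext z
    simp [J, ← mul_smul]
  have h : (complexLinearAd x).restrictScalars ℝ =
      (2⁻¹ : ℝ) • (LieAlgebra.ad ℝ 𝔤 x - J ∘ₗ (LieAlgebra.ad ℝ 𝔤 x ∘ₗ J)) := by
    ext z
    simp [J, complexLinearAd_apply]
  rw [h, map_smul, map_sub, LinearMap.trace_comp_comm', LinearMap.comp_assoc, hJ]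
  simp only [LinearMap.comp_neg, LinearMap.comp_id, map_neg, smul_eq_mul]
  ring

/-- The trace at ix is -i times the trace at x, and its real part is the imaginary part at x. So the
real parts at x and ix determine the complex trace. -/
theorem trace_complexLinearAd_eq_zero_iff [FiniteDimensional ℂ 𝔤]
    (hlie : ∀ x y : 𝔤, ⁅Complex.I • x, Complex.I • y⁆ = ⁅x, y⁆) :
    (∀ x : 𝔤, LinearMap.trace ℂ 𝔤 (complexLinearAd x) = 0) ↔ IsUnimodularLieAlgebra 𝔤 := by
  refine ⟨fun h x ↦ ?_, fun h x ↦ ?_⟩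
  · rw [← two_mul_re_trace_complexLinearAd, h, Complex.zero_re, mul_zero]
  · have h1 := (two_mul_re_trace_complexLinearAd x).trans (h x)
    have h2 := (two_mul_re_trace_complexLinearAd (Complex.I • x)).trans (h _)
    rw [complexLinearAd_I_smul hlie, map_smul] at h2
    simp at h1 h2
    exact Complex.ext h1 h2

theorem lieFormDifferential_eq_sum_trace
    (hlie : ∀ x y : 𝔤, ⁅Complex.I • x, Complex.I • y⁆ = ⁅x, y⁆) {n : ℕ}
    (b : Module.Basis (Fin n) ℂ 𝔤)
    (σ : 𝔤 [⋀^Fin n]→ₗ[ℝ] ℂ) (τ : 𝔤 [⋀^Fin n]→ₗ[ℂ] ℂ) (hτ : ∀ v, τ v = σ v)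
    (x : Fin (n + 1) → 𝔤) :
    lieFormDifferential σ x = -∑ i : Fin (n + 1), (-1 : ℂ) ^ (i : ℕ) *
      (LinearMap.trace ℂ 𝔤 (complexLinearAd (x i)) * σ (i.removeNth x)) := by
  -- `c i j` lets A_{x_i} act on x_j with x_i deleted. Each pair i < j of the differential gives -c
  -- i j - c j i, so the double sum runs over all ordered pairs of distinct indices; for fixed i the
  -- sum over j is a trace.
  let c (i j : Fin (n + 1)) : ℂ :=
    (-1 : ℂ) ^ (i : ℕ) * σ (i.removeNth (Function.update x j (complexLinearAd (x i) (x j))))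
  have hc {i j : Fin (n + 1)} (hij : i ≠ j) : (-1 : ℂ) ^ (j : ℕ) *
      σ (j.removeNth (Function.update x i ⁅x i, x j⁆)) = -c i j - c j i := by
    have h := σ.neg_one_pow_smul_map_removeNth_update x hij (complexLinearAd (x i) (x j))
    simp only [zsmul_eq_mul, Int.cast_pow, Int.cast_neg, Int.cast_one] at h
    obtain ⟨k, rfl⟩ := Fin.exists_succAbove_eq hij
    simp only [c]
    rw [← h, ← mul_sub]
    simp only [Fin.removeNth_update_succAbove]
    rw [← σ.map_update_sub, complexLinearAd_sub_complexLinearAd hlie]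
  have hS : lieFormDifferential σ x = ∑ j : Fin (n + 1), ∑ i ∈ Finset.Iio j, (-c i j - c j i) :=
    Finset.sum_congr rfl fun j _ ↦ Finset.sum_congr rfl fun i hi ↦
      hc (Finset.mem_Iio.1 hi).ne
  have hT (i : Fin (n + 1)) : ∑ k, c i (i.succAbove k) = (-1 : ℂ) ^ (i : ℕ) *
      (LinearMap.trace ℂ 𝔤 (complexLinearAd (x i)) * σ (i.removeNth x)) := by
    have h := τ.sum_map_update_eq_trace_smul b (complexLinearAd (x i)) (i.removeNth x)
    simp only [hτ, smul_eq_mul] at h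
    rw [← h, Finset.mul_sum]
    refine Finset.sum_congr rfl fun k _ ↦ ?_
    simp only [c, Fin.removeNth_update_succAbove]
    rfl
  rw [hS]
  simp only [← hT, Finset.sum_sub_distrib, Finset.sum_neg_distrib]
  rw [← neg_add', neg_inj]
  have hU (i : Fin (n + 1)) : ∑ k, c i (i.succAbove k) =
      ∑ j ∈ Finset.Ioi i, c i j + ∑ j ∈ Finset.Iio i, c i j := by
    rw [← Finset.sum_union (by
      rw [Finset.disjoint_left]; intro j hj hj'
      exact lt_asymm (Finset.mem_Ioi.1 hj) (Finset.mem_Iio.1 hj'))]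
    have h1 := Fin.sum_univ_succAbove (c i) i
    have h2 : (Finset.univ : Finset (Fin (n + 1))) =
        insert i (Finset.Ioi i ∪ Finset.Iio i) := by
      ext j
      have := lt_trichotomy i j
      simp; tauto
    rw [h2, Finset.sum_insert (by simp)] at h1
    exact (add_left_cancel h1).symm
  simp only [hU, Finset.sum_add_distrib]
  congr 1
  exact Finset.sum_comm' (by simp)

end AbelianComplexStructure

/-! ### Closed (n, 0)-forms and unimodularity -/

section ClosedForms

/-- The complex vector space structure given by a real endomorphism `J` with `J² = -1`. -/
abbrev LinearMap.complexModule {V : Type*} [AddCommGroup V] [Module ℝ V] (J : V →ₗ[ℝ] V)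
    (hJ : ∀ x, J (J x) = -x) : Module ℂ V :=
  Module.compHom V (Complex.lift ⟨J, LinearMap.ext fun x ↦ by simp [hJ]⟩ :
    ℂ →ₐ[ℝ] Module.End ℝ V).toRingHom

theorem LinearMap.complexModule_I_smul {V : Type*} [AddCommGroup V] [Module ℝ V] (J : V →ₗ[ℝ] V)
    (hJ : ∀ x, J (J x) = -x) (x : V) :
    letI := J.complexModule hJ
    Complex.I • x = J x := by
  change (Complex.lift ⟨J, LinearMap.ext fun x ↦ by simp [hJ]⟩ : ℂ →ₐ[ℝ] Module.End ℝ V)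
    Complex.I x = J x
  simp

theorem LinearMap.complexModule_isScalarTower {V : Type*} [AddCommGroup V] [Module ℝ V]
    (J : V →ₗ[ℝ] V) (hJ : ∀ x, J (J x) = -x) :
    letI := J.complexModule hJ
    IsScalarTower ℝ ℂ V := by
  let := J.complexModule hJ
  refine ⟨fun r c x ↦ ?_⟩
  change (Complex.lift ⟨J, LinearMap.ext fun x ↦ by simp [hJ]⟩ : ℂ →ₐ[ℝ] Module.End ℝ V) (r • c) x =
    r • (Complex.lift ⟨J, LinearMap.ext fun x ↦ by simp [hJ]⟩ : ℂ →ₐ[ℝ] Module.End ℝ V) c x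
  rw [map_smul, LinearMap.smul_apply]

/-- A form of type `(k, 0)` is complex multilinear. -/
theorem IsTypeKZero.exists_complex_alternatingMap {V : Type*} [AddCommGroup V] [Module ℝ V]
    [Module ℂ V] [IsScalarTower ℝ ℂ V] {k : ℕ} {σ : V [⋀^Fin k]→ₗ[ℝ] ℂ}
    (hσ : IsTypeKZero (fun x : V ↦ Complex.I • x) σ) :
    ∃ τ : V [⋀^Fin k]→ₗ[ℂ] ℂ, ∀ v, τ v = σ v := by
  refine ⟨{ toFun := σ, map_update_add' := ?_, map_update_smul' := ?_,
            map_eq_zero_of_eq' := fun v i j h hij ↦ σ.map_eq_zero_of_eq v h hij }, fun v ↦ rfl⟩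
  · intro inst v i x y
    obtain rfl : inst = instDecidableEqFin k := Subsingleton.elim _ _
    exact σ.map_update_add v i x y
  · intro inst v i c x
    obtain rfl : inst = instDecidableEqFin k := Subsingleton.elim _ _
    have hr (r : ℝ) (z : V) : (r : ℂ) • z = r • z := algebraMap_smul ℂ r z
    have hI := hσ (Function.update v i x) i
    rw [Function.update_self, Function.update_idem] at hI
    conv_lhs => rw [← Complex.re_add_im c, add_smul, mul_smul, hr, hr]
    rw [σ.map_update_add, σ.map_update_smul, σ.map_update_smul, hI]
    conv_rhs => rw [← Complex.re_add_im c]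
    simp only [Complex.real_smul, smul_eq_mul]
    ring

theorem complexLinearAd_add {𝔤 : Type*} [LieRing 𝔤] [LieAlgebra ℝ 𝔤] [Module ℂ 𝔤]
    [IsScalarTower ℝ ℂ 𝔤] (x y : 𝔤) :
    complexLinearAd (x + y) = complexLinearAd x + complexLinearAd y := by
  ext z
  simp only [LinearMap.add_apply, complexLinearAd_apply, add_lie, smul_add]
  module

theorem complexLinearAd_zero {𝔤 : Type*} [LieRing 𝔤] [LieAlgebra ℝ 𝔤] [Module ℂ 𝔤]
    [IsScalarTower ℝ ℂ 𝔤] : complexLinearAd (0 : 𝔤) = 0 := by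
  ext z
  simp [complexLinearAd_apply]

/-- This conjugate linearity lets vanishing of the trace spread from a complex basis to the whole
space. -/
theorem complexLinearAd_smul {𝔤 : Type*} [LieRing 𝔤] [LieAlgebra ℝ 𝔤] [Module ℂ 𝔤]
    [IsScalarTower ℝ ℂ 𝔤] (hlie : ∀ x y : 𝔤, ⁅Complex.I • x, Complex.I • y⁆ = ⁅x, y⁆)
    (c : ℂ) (x : 𝔤) :
    complexLinearAd (c • x) = starRingEnd ℂ c • complexLinearAd x := by
  have hr {V : Type _} [AddCommGroup V] [Module ℝ V] [Module ℂ V] [IsScalarTower ℝ ℂ V]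
    (r : ℝ) (z : V) : (r : ℂ) • z = r • z := algebraMap_smul ℂ r z
  have hreal (r : ℝ) (x : 𝔤) : complexLinearAd (r • x) = (r : ℂ) • complexLinearAd x := by
    ext z
    rw [LinearMap.smul_apply, hr]
    simp only [complexLinearAd_apply, smul_lie, smul_comm Complex.I r, ← smul_sub]
    exact smul_comm _ _ _
  conv_lhs => rw [← Complex.re_add_im c, add_smul, mul_smul, hr, hr]
  rw [complexLinearAd_add, hreal, hreal, complexLinearAd_I_smul hlie, ← mul_smul, ← add_smul]
  congr 1
  apply Complex.ext <;> simp

theorem exists_closed_form_iff_isUnimodular_of_complexModule {𝔤 : Type*} [LieRing 𝔤]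
    [LieAlgebra ℝ 𝔤] [Module ℂ 𝔤] [IsScalarTower ℝ ℂ 𝔤] [FiniteDimensional ℂ 𝔤] {n : ℕ}
    (hn : Module.finrank ℂ 𝔤 = n)
    (hlie : ∀ x y : 𝔤, ⁅Complex.I • x, Complex.I • y⁆ = ⁅x, y⁆) :
    (∃ σ : 𝔤 [⋀^Fin n]→ₗ[ℝ] ℂ, σ ≠ 0 ∧ IsTypeKZero (fun x : 𝔤 ↦ Complex.I • x) σ ∧
      ∀ x, lieFormDifferential σ x = 0) ↔ IsUnimodularLieAlgebra 𝔤 := by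
  let b : Module.Basis (Fin n) ℂ 𝔤 := Module.finBasisOfFinrankEq ℂ 𝔤 hn
  rw [← trace_complexLinearAd_eq_zero_iff hlie]
  constructor
  · rintro ⟨σ, hσ0, hσJ, hσd⟩
    obtain ⟨τ, hτ⟩ := hσJ.exists_complex_alternatingMap
    have hb : τ b ≠ 0 := by
      intro h
      apply hσ0
      ext v
      rw [← hτ, τ.eq_smul_basis_det b, h]
      simp
    have key (k : Fin n) : LinearMap.trace ℂ 𝔤 (complexLinearAd (b k)) = 0 := by
      have hrem (w : 𝔤) (j : Fin n) :
          (-1 : ℂ) ^ (j.succ : ℕ) * τ (j.succ.removeNth (Fin.cons w b : Fin (n + 1) → 𝔤)) =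
            -τ (Function.update b j w) := by
        have e := τ.neg_one_pow_smul_map_removeNth_update (Fin.cons (0 : 𝔤) b)
          (Fin.succ_ne_zero j).symm w
        have e1 : Function.update (Fin.cons (0 : 𝔤) b : Fin (n + 1) → 𝔤) 0 w =
            Fin.cons w b := Fin.update_cons_zero ..
        have e2 : Function.update (Fin.cons (0 : 𝔤) b : Fin (n + 1) → 𝔤) j.succ w =
            Fin.cons 0 (Function.update b j w) := (Fin.cons_update ..).symm
        rw [e1, e2] at e
        simpa using e
      -- Only deleting slot 0 or the slot of b_k leaves independent vectors. The first term carries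
      -- -i from conjugate linearity of the trace; the second carries i from linearity of `τ` and a
      -- sign from moving the vector. They therefore add up to a factor -2i instead of cancelling.
      have h := hσd (Fin.cons (Complex.I • b k) b)
      rw [lieFormDifferential_eq_sum_trace hlie b σ τ hτ, neg_eq_zero, Fin.sum_univ_succ] at h
      simp only [← hτ, mul_left_comm _ (LinearMap.trace ℂ 𝔤 _), hrem, Fin.cons_zero, Fin.cons_succ,
        τ.map_update_smul] at h
      rw [Finset.sum_eq_single k (fun j _ hj ↦ by rw [τ.map_update_self _ hj]; simp) (by simp),
        Function.update_eq_self, complexLinearAd_I_smul hlie] at h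
      simp only [Fin.val_zero, pow_zero, one_mul, Fin.removeNth_zero, Fin.tail_cons, map_smul,
        smul_eq_mul] at h
      have : -2 * Complex.I * τ b * LinearMap.trace ℂ 𝔤 (complexLinearAd (b k)) = 0 := by
        linear_combination h
      simpa [hb] using this
    intro x
    induction b.mem_span x using Submodule.span_induction with
    | mem x hx => obtain ⟨k, rfl⟩ := hx; exact key k
    | zero => simp [complexLinearAd_zero]
    | add x y _ _ hx hy => rw [complexLinearAd_add, map_add, hx, hy, add_zero]
    | smul c x _ hx => rw [complexLinearAd_smul hlie, map_smul, hx, smul_zero]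
  · intro h
    refine ⟨{ b.det.toMultilinearMap.restrictScalars ℝ with
      map_eq_zero_of_eq' := fun v i j h hij ↦ b.det.map_eq_zero_of_eq v h hij }, ?_, ?_, ?_⟩
    · intro h0
      have := congrArg (fun f ↦ f b) h0
      simp at this
      exact one_ne_zero (b.det_self.symm.trans this)
    · intro v i
      exact (b.det.map_update_smul v i Complex.I (v i)).trans (by rw [Function.update_eq_self]; rfl)
    · intro x
      rw [lieFormDifferential_eq_sum_trace hlie b _ b.det (fun v ↦ rfl)]
      simp [h]

theorem exists_closed_form_iff_isUnimodularLieAlgebra {n : ℕ} {𝔤 : Type*} [LieRing 𝔤]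
    [LieAlgebra ℝ 𝔤] [FiniteDimensional ℝ 𝔤] (J : 𝔤 →ₗ[ℝ] 𝔤)
    (hn : Module.finrank ℝ 𝔤 = 2 * n) (hJ : IsAbelianComplexStructure J) :
    (∃ σ : 𝔤 [⋀^Fin n]→ₗ[ℝ] ℂ, σ ≠ 0 ∧ IsTypeKZero J σ ∧ ∀ x, lieFormDifferential σ x = 0) ↔
      IsUnimodularLieAlgebra 𝔤 := by
  let := J.complexModule hJ.sq_eq_neg
  have : IsScalarTower ℝ ℂ 𝔤 := J.complexModule_isScalarTower hJ.sq_eq_neg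
  have : FiniteDimensional ℂ 𝔤 := FiniteDimensional.right ℝ ℂ 𝔤
  have hI : (fun x : 𝔤 ↦ Complex.I • x) = J := funext (J.complexModule_I_smul hJ.sq_eq_neg)
  have hn' : Module.finrank ℂ 𝔤 = n := by
    have := Module.finrank_mul_finrank ℝ ℂ 𝔤
    rw [Complex.finrank_real_complex, hn] at this
    omega
  rw [← exists_closed_form_iff_isUnimodular_of_complexModule hn', hI]
  intro x y
  rw [congrFun hI x, congrFun hI y, hJ.lie_map_map]

end ClosedForms

/-! ### Exterior derivative on frames with constant pairings -/

section ExteriorDerivative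

/-- Evaluation on tuples of basis vectors embeds the alternating maps linearly into a
finite-dimensional product. A linear left inverse recovers the map from those values. -/
theorem contDiffOn_continuousAlternatingMap_of_apply {D F H : Type*}
    [NormedAddCommGroup D] [NormedSpace ℝ D] [NormedAddCommGroup F] [NormedSpace ℝ F]
    [FiniteDimensional ℝ F] [NormedAddCommGroup H] [NormedSpace ℝ H] [FiniteDimensional ℝ H]
    {n : ℕ} {r : ℕ∞ω} {s : Set D} {η : D → F [⋀^Fin n]→L[ℝ] H}
    (h : ∀ w, ContDiffOn ℝ r (fun y ↦ η y w) s) : ContDiffOn ℝ r η s := by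
  let b := Module.finBasis ℝ F
  let L : (F [⋀^Fin n]→L[ℝ] H) →ₗ[ℝ] ((Fin n → Fin (Module.finrank ℝ F)) → H) :=
    { toFun := fun σ t ↦ σ fun i ↦ b (t i)
      map_add' := fun _ _ ↦ rfl
      map_smul' := fun _ _ ↦ rfl }
  have hL : Function.Injective L := fun σ τ hστ ↦ by
    apply ContinuousAlternatingMap.toContinuousMultilinearMap_injective
    apply ContinuousMultilinearMap.toMultilinearMap_injective
    exact Module.Basis.ext_multilinear (fun _ ↦ b) fun t ↦ congrFun hστ t
  have : FiniteDimensional ℝ (F [⋀^Fin n]→L[ℝ] H) := FiniteDimensional.of_injective L hL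
  obtain ⟨R, hR⟩ := L.exists_leftInverse_of_injective (LinearMap.ker_eq_bot.2 hL)
  have hη : η = fun y ↦ R.toContinuousLinearMap (L (η y)) :=
    funext fun y ↦ (LinearMap.congr_fun hR (η y)).symm
  rw [hη]
  exact R.toContinuousLinearMap.contDiff.comp_contDiffOn (contDiffOn_pi.2 fun t ↦ h _)

/-- In the vector field formula for the exterior derivative, the terms differentiating η(X, …)
vanish because these functions are locally constant. Only the bracket terms remain. -/
theorem extDeriv_apply_eq_lieFormDifferential {E 𝔤 : Type*} [NormedAddCommGroup E]
    [NormedSpace ℝ E] [LieRing 𝔤] [LieAlgebra ℝ 𝔤] {n : ℕ} {η : E → E [⋀^Fin n]→L[ℝ] ℂ}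
    {σ : 𝔤 [⋀^Fin n]→ₗ[ℝ] ℂ} {X : 𝔤 → E → E} {y : E} (hη : DifferentiableAt ℝ η y)
    (hX : ∀ v, DifferentiableAt ℝ (X v) y)
    (hlie : ∀ v w, VectorField.lieBracket ℝ (X v) (X w) y = X ⁅v, w⁆ y)
    (hηX : ∀ᶠ z in 𝓝 y, ∀ v : Fin n → 𝔤, η z (fun i ↦ X (v i) z) = σ v)
    (v : Fin (n + 1) → 𝔤) :
    extDeriv η y (fun i ↦ X (v i) y) = lieFormDifferential σ v := by
  have h0 (i : Fin (n + 1)) : fderiv ℝ (fun z ↦ η z (i.removeNth fun j ↦ X (v j) z)) y = 0 := by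
    have : (fun z ↦ η z (i.removeNth fun j ↦ X (v j) z)) =ᶠ[𝓝 y] fun _ ↦ σ (i.removeNth v) := by
      filter_upwards [hηX] with z hz
      exact hz (i.removeNth v)
    rw [this.fderiv_eq, fderiv_const_apply]
  cases n with
  | zero =>
    -- In degree zero there is a single field, so pairwise commutation is vacuous.
    rw [extDeriv_apply_vectorField_of_pairwise_commute (V := fun i ↦ X (v i)) hη (fun i ↦ hX _)
      (fun i j hij ↦ (hij (by omega)).elim)]
    simp only [h0]
    simp [lieFormDifferential, show Finset.Iio (0 : Fin 1) = ∅ by ext; simp]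
  | succ n =>
    rw [extDeriv_apply_vectorField (V := fun i ↦ X (v i)) hη (fun i ↦ hX _)]
    simp only [h0, hlie]
    have hy := hηX.self_of_nhds
    -- The pair is `i.castSucc < j.succ`. Moving the bracket from the front to slot `i` costs
    -- (-1)^i, and passing from `j` to `j.succ` accounts for the minus sign.
    have key (i j : Fin (n + 1)) (hij : i ≤ j) :
        (-1 : ℤ) ^ (i + j : ℕ) • η y (Matrix.vecCons (X ⁅v i.castSucc, v j.succ⁆ y)
          (j.removeNth <| i.castSucc.removeNth fun k ↦ X (v k) y)) =
        -((-1 : ℂ) ^ (j.succ : ℕ) * σ (j.succ.removeNth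
          (Function.update v i.castSucc ⁅v i.castSucc, v j.succ⁆))) := by
      set w := ⁅v i.castSucc, v j.succ⁆
      have e1 : (Matrix.vecCons (X w y) (j.removeNth <| i.castSucc.removeNth fun k ↦ X (v k) y)) =
          fun k ↦ X ((Fin.cons w (j.removeNth <| i.castSucc.removeNth v) :
            Fin (n + 1) → 𝔤) k) y := by
        funext k
        refine Fin.cases ?_ (fun k ↦ ?_) k <;> rfl
      have hi : j.succ.succAbove i = i.castSucc :=
        Fin.succAbove_of_castSucc_lt _ _ (Fin.castSucc_lt_succ_iff.2 hij)
      have hk (k : Fin n) :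
          j.succ.succAbove (i.succAbove k) = i.castSucc.succAbove (j.succAbove k) := by
        have := Fin.le_def.1 hij
        ext
        simp only [Fin.succAbove, Fin.lt_def]
        split_ifs <;> simp_all <;> omega
      have e2 : j.succ.removeNth (Function.update v i.castSucc w) =
          i.insertNth w (j.removeNth <| i.castSucc.removeNth v) := by
        funext k
        refine i.succAboveCases ?_ (fun k ↦ ?_) k
        · rw [Fin.insertNth_apply_same, Fin.removeNth_apply, hi, Function.update_self]
        · rw [Fin.insertNth_apply_succAbove, Fin.removeNth_apply, hk,
            Function.update_of_ne (Fin.succAbove_ne _ _)]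
          rfl
      rw [e1, hy, e2, AlternatingMap.map_insertNth, zsmul_eq_mul, zsmul_eq_mul, Matrix.vecCons]
      push_cast
      rw [Fin.val_succ, pow_add, pow_succ]
      ring
    have hsum : lieFormDifferential σ v = ∑ i : Fin (n + 1), ∑ j ∈ Finset.Ici i,
        (-1 : ℂ) ^ (j.succ : ℕ) * σ (j.succ.removeNth
          (Function.update v i.castSucc ⁅v i.castSucc, v j.succ⁆)) := by
      rw [lieFormDifferential, Fin.sum_univ_succ]
      have h1 (j : Fin (n + 1)) : Finset.Iio j.succ = (Finset.Iic j).map Fin.castSuccEmb := by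
        rw [Fin.map_castSuccEmb_Iic]
        ext k
        simp [Fin.lt_def, Fin.le_def]
      simp only [h1, Finset.sum_map, Fin.coe_castSuccEmb]
      rw [show Finset.Iio (0 : Fin (n + 2)) = ∅ by ext; simp, Finset.sum_empty, zero_add]
      exact Finset.sum_comm' (by simp)
    rw [hsum]
    simp only [zero_apply, smul_zero, Finset.sum_const_zero,
      zero_sub, ← Finset.sum_neg_distrib]
    refine Finset.sum_congr rfl fun i _ ↦ Finset.sum_congr rfl fun j hj ↦ ?_
    rw [neg_eq_iff_eq_neg]
    exact key i j (Finset.mem_Ici.1 hj)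

end ExteriorDerivative

/-! ### Maurer-Cartan form and invariant fields in charts -/

section LieGroupCharts

/-- Smoothness of `mfderiv` in parameters is available only in tangent coordinates. When the target
base point does not move, these are the identity change of coordinates. -/
theorem inTangentCoordinates_eq_self {E E' M N : Type*} [NormedAddCommGroup E]
    [NormedSpace ℝ E] [NormedAddCommGroup E'] [NormedSpace ℝ E'] [TopologicalSpace M]
    [ChartedSpace E' M] [IsManifold 𝓘(ℝ, E') 1 M] {f : N → E} {g : N → M} {ϕ : N → E →L[ℝ] E'}
    {x₀ x : N} (hg : g x = g x₀) :
    inTangentCoordinates 𝓘(ℝ, E) 𝓘(ℝ, E') f g ϕ x₀ x = ϕ x := by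
  have hf : f x ∈ (chartAt E (f x₀)).source := Set.mem_univ _
  rw [inTangentCoordinates_eq _ _ _ hf (by rw [hg]; exact mem_chart_source _ _), hg]
  ext u
  simp only [ContinuousLinearMap.comp_apply]
  rw [(tangentBundleCore 𝓘(ℝ, E') M).coordChange_self _ _ (mem_chart_source E' (g x₀))]
  simp

variable {E : Type*} [NormedAddCommGroup E] [NormedSpace ℝ E]
  {G : Type*} [TopologicalSpace G] [ChartedSpace E G] [Group G] [LieGroup 𝓘(ℝ, E) ∞ G]

/-- The left Maurer-Cartan form of `G` in the preferred chart at `g₀`. -/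
noncomputable def maurerCartanInChart (g₀ : G) (y : E) : E →L[ℝ] E :=
  mfderiv 𝓘(ℝ, E) 𝓘(ℝ, E)
    (fun z ↦ ((extChartAt 𝓘(ℝ, E) g₀).symm y)⁻¹ * (extChartAt 𝓘(ℝ, E) g₀).symm z) y

theorem contMDiffAt_extChartAt_symm {g₀ : G} {y : E} (hy : y ∈ (extChartAt 𝓘(ℝ, E) g₀).target) :
    ContMDiffAt 𝓘(ℝ, E) 𝓘(ℝ, E) ∞ (extChartAt 𝓘(ℝ, E) g₀).symm y :=
  (contMDiffOn_extChartAt_symm g₀).contMDiffAt ((isOpen_extChartAt_target g₀).mem_nhds hy)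

theorem contDiffOn_maurerCartanInChart (g₀ : G) :
    ContDiffOn ℝ ∞ (maurerCartanInChart g₀) (extChartAt 𝓘(ℝ, E) g₀).target := by
  intro y hy
  have hφ := contMDiffAt_extChartAt_symm hy
  have h1 : ContMDiffAt (𝓘(ℝ, E).prod 𝓘(ℝ, E)) 𝓘(ℝ, E) ∞
      (Function.uncurry fun y z : E ↦
        ((extChartAt 𝓘(ℝ, E) g₀).symm y)⁻¹ * (extChartAt 𝓘(ℝ, E) g₀).symm z) (y, y) := by
    refine ContMDiffAt.mul ?_ ?_
    · exact (ContMDiffAt.comp (y, y) hφ contMDiffAt_fst).inv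
    · exact ContMDiffAt.comp (y, y) hφ contMDiffAt_snd
  have h2 := ContMDiffAt.mfderiv (m := ∞) (n := ∞) _ (fun y : E ↦ y) h1 contMDiffAt_id le_rfl
  rw [contMDiffAt_iff_contDiffAt] at h2
  exact (h2.congr_of_eventuallyEq (Filter.Eventually.of_forall fun z ↦
    (inTangentCoordinates_eq_self (by simp)).symm)).contDiffWithinAt

/-- Chain rule for the inverse chart written as left translation by its value at `y`, after the map
whose derivative is the Maurer-Cartan form. -/
theorem mfderiv_extChartAt_symm_apply {g₀ : G} {y : E} (hy : y ∈ (extChartAt 𝓘(ℝ, E) g₀).target)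
    (u : E) : (mfderiv 𝓘(ℝ, E) 𝓘(ℝ, E) (extChartAt 𝓘(ℝ, E) g₀).symm y u : E) =
      mulInvariantVectorField (I := 𝓘(ℝ, E)) (G := G) (maurerCartanInChart g₀ y u)
        ((extChartAt 𝓘(ℝ, E) g₀).symm y) := by
  have hn : (∞ : ℕ∞ω) ≠ 0 := by simp
  set φ := extChartAt 𝓘(ℝ, E) g₀
  have hφ := contMDiffAt_extChartAt_symm hy
  have h1 : MDifferentiableAt 𝓘(ℝ, E) 𝓘(ℝ, E) (fun z ↦ (φ.symm y)⁻¹ * φ.symm z) y :=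
    (contMDiffAt_const.mul hφ).mdifferentiableAt hn
  have h2 : MDifferentiableAt 𝓘(ℝ, E) 𝓘(ℝ, E) (fun h ↦ φ.symm y * h)
      ((φ.symm y)⁻¹ * φ.symm y) := contMDiffAt_mul_left.mdifferentiableAt hn
  have h3 := mfderiv_comp_apply (I := 𝓘(ℝ, E)) (I' := 𝓘(ℝ, E)) (I'' := 𝓘(ℝ, E)) y h2 h1 u
  have h4 : (fun h ↦ φ.symm y * h) ∘ (fun z ↦ (φ.symm y)⁻¹ * φ.symm z) = φ.symm := by
    funext z; simp
  rw [h4] at h3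
  refine h3.trans ?_
  rw [inv_mul_cancel]
  rfl

theorem isInvertible_mfderiv_extChartAt_symm {g₀ : G} {y : E}
    (hy : y ∈ (extChartAt 𝓘(ℝ, E) g₀).target) :
    (mfderiv 𝓘(ℝ, E) 𝓘(ℝ, E) (extChartAt 𝓘(ℝ, E) g₀).symm y).IsInvertible := by
  have := isInvertible_mfderivWithin_extChartAt_symm (I := 𝓘(ℝ, E)) hy
  simpa using this

/-- The left invariant vector field with value `v` at `1` in the preferred chart at `g₀`. -/
noncomputable def invariantFieldInChart (g₀ : G) (v : GroupLieAlgebra 𝓘(ℝ, E) G) (y : E) : E :=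
  VectorField.mpullback 𝓘(ℝ, E) 𝓘(ℝ, E) (extChartAt 𝓘(ℝ, E) g₀).symm
    (mulInvariantVectorField v) y

theorem mfderiv_invariantFieldInChart {g₀ : G} {y : E}
    (hy : y ∈ (extChartAt 𝓘(ℝ, E) g₀).target) (v : GroupLieAlgebra 𝓘(ℝ, E) G) :
    (mfderiv 𝓘(ℝ, E) 𝓘(ℝ, E) (extChartAt 𝓘(ℝ, E) g₀).symm y : E →L[ℝ] E)
      (invariantFieldInChart (E := E) g₀ v y) =
        mulInvariantVectorField v ((extChartAt 𝓘(ℝ, E) g₀).symm y) :=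
  (isInvertible_mfderiv_extChartAt_symm hy).self_apply_inverse _

theorem invariantFieldInChart_maurerCartanInChart {g₀ : G} {y : E}
    (hy : y ∈ (extChartAt 𝓘(ℝ, E) g₀).target) (u : E) :
    invariantFieldInChart (G := G) g₀ (maurerCartanInChart g₀ y u) y = u := by
  apply (isInvertible_mfderiv_extChartAt_symm hy).injective
  exact (mfderiv_invariantFieldInChart hy _).trans (mfderiv_extChartAt_symm_apply hy u).symm

theorem mulInvariantVectorField_injective (g : G) :
    Function.Injective fun v : GroupLieAlgebra 𝓘(ℝ, E) G ↦ mulInvariantVectorField v g := by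
  have hn : (∞ : ℕ∞ω) ≠ 0 := by simp
  have hL : IsLocalDiffeomorph 𝓘(ℝ, E) 𝓘(ℝ, E) ∞ (fun h : G ↦ g * h) :=
    Diffeomorph.isLocalDiffeomorph (Φ := ⟨Equiv.mulLeft g, contMDiff_mul_left, contMDiff_mul_left⟩)
  exact ((hL 1).mfderivToContinuousLinearEquiv hn).injective

theorem maurerCartanInChart_invariantFieldInChart {g₀ : G} {y : E}
    (hy : y ∈ (extChartAt 𝓘(ℝ, E) g₀).target) (v : GroupLieAlgebra 𝓘(ℝ, E) G) :
    maurerCartanInChart g₀ y (invariantFieldInChart g₀ v y) = v := by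
  apply mulInvariantVectorField_injective ((extChartAt 𝓘(ℝ, E) g₀).symm y)
  exact (mfderiv_extChartAt_symm_apply hy _).symm.trans (mfderiv_invariantFieldInChart hy v)

/-- The field is the inverse of the Maurer-Cartan form applied to `v`; that form is smooth, and
inversion of operators is differentiable at invertible ones. -/
theorem differentiableAt_invariantFieldInChart [CompleteSpace E] {g₀ : G} {y : E}
    (hy : y ∈ (extChartAt 𝓘(ℝ, E) g₀).target) (v : GroupLieAlgebra 𝓘(ℝ, E) G) :
    DifferentiableAt ℝ (invariantFieldInChart g₀ v) y := by
  have hopen := (isOpen_extChartAt_target (I := 𝓘(ℝ, E)) g₀).mem_nhds hy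
  have hinv {z : E} (hz : z ∈ (extChartAt 𝓘(ℝ, E) g₀).target) :
      ∃ e : E ≃L[ℝ] E, (e : E →L[ℝ] E) = maurerCartanInChart g₀ z ∧
        ∀ v : E, e.symm v = invariantFieldInChart (E := E) (G := G) g₀ v z := by
    let e' : E ≃ₗ[ℝ] E := LinearEquiv.ofBijective (maurerCartanInChart g₀ z).toLinearMap
      ⟨fun u w h ↦ by
        rw [← invariantFieldInChart_maurerCartanInChart hz u,
          ← invariantFieldInChart_maurerCartanInChart hz w]
        exact congrArg (fun x ↦ invariantFieldInChart (E := E) (G := G) g₀ x z) h,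
      fun v ↦ ⟨_, maurerCartanInChart_invariantFieldInChart hz v⟩⟩
    let e : E ≃L[ℝ] E :=
      e'.toContinuousLinearEquivOfContinuous (maurerCartanInChart g₀ z).continuous
    refine ⟨e, by ext; rfl, fun v ↦ ?_⟩
    rw [e.symm_apply_eq]
    exact (maurerCartanInChart_invariantFieldInChart hz v).symm
  obtain ⟨e, he, -⟩ := hinv hy
  have h1 : DifferentiableAt ℝ (maurerCartanInChart g₀) y :=
    ((contDiffOn_maurerCartanInChart g₀).contDiffAt hopen).differentiableAt (by simp)
  have h2 : DifferentiableAt ℝ (ContinuousLinearMap.inverse : (E →L[ℝ] E) → E →L[ℝ] E)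
      (maurerCartanInChart g₀ y) := by
    rw [← he]
    exact (contDiffAt_map_inverse (n := 1) e).differentiableAt (by simp)
  have h3 : DifferentiableAt ℝ (fun z ↦ (maurerCartanInChart (E := E) g₀ z).inverse v) y :=
    (h2.comp y h1).clm_apply (differentiableAt_const _)
  refine h3.congr_of_eventuallyEq ?_
  filter_upwards [hopen] with z hz
  obtain ⟨e, he, hev⟩ := hinv hz
  refine (hev v).symm.trans ?_
  rw [← he, ContinuousLinearMap.inverse_equiv]
  rfl

theorem mlieBracket_eq_lieBracket {E : Type*} [NormedAddCommGroup E] [NormedSpace ℝ E]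
    {V W : E → E} :
    VectorField.mlieBracket 𝓘(ℝ, E) V W = VectorField.lieBracket ℝ V W := by
  rw [← VectorField.lieBracketWithin_univ]
  exact (VectorField.mlieBracketWithin_univ (I := 𝓘(ℝ, E)) (M := E)).symm.trans
    VectorField.mlieBracketWithin_eq_lieBracketWithin

theorem lieBracket_invariantFieldInChart [CompleteSpace E] {g₀ : G} {y : E}
    (hy : y ∈ (extChartAt 𝓘(ℝ, E) g₀).target) (v w : GroupLieAlgebra 𝓘(ℝ, E) G) :
    VectorField.lieBracket ℝ (invariantFieldInChart g₀ v) (invariantFieldInChart g₀ w) y =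
      invariantFieldInChart g₀ ⁅v, w⁆ y := by
  have h := VectorField.mpullback_mlieBracket (n := ∞) (I := 𝓘(ℝ, E)) (I' := 𝓘(ℝ, E))
    (mdifferentiableAt_mulInvariantVectorField v (g := (extChartAt 𝓘(ℝ, E) g₀).symm y))
    (mdifferentiableAt_mulInvariantVectorField w) (contMDiffAt_extChartAt_symm hy)
    (by rw [minSmoothness_of_isRCLikeNormedField]; exact ENat.LEInfty.out)
  refine (congrFun mlieBracket_eq_lieBracket.symm y).trans (h.symm.trans ?_)
  rw [← mulInvariantVector_mlieBracket]
  rfl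

end LieGroupCharts

/-! ### Invariant forms on Γ\G -/

section InvariantForms

theorem MultilinearMap.continuous_of_finiteDimensional {E F ι : Type*} [NormedAddCommGroup E]
    [NormedSpace ℝ E] [FiniteDimensional ℝ E] [NormedAddCommGroup F] [NormedSpace ℝ F] [Fintype ι]
    (f : MultilinearMap ℝ (fun _ : ι ↦ E) F) : Continuous f := by
  classical
  let b := Module.finBasis ℝ E
  have h : ⇑f = fun v ↦ ∑ t : ι → Fin (Module.finrank ℝ E),
      (∏ i, b.coord (t i) (v i)) • f fun i ↦ b (t i) := by
    funext v
    conv_lhs => rw [show v = fun i ↦ ∑ j, b.coord j (v i) • b j from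
      funext fun i ↦ (b.sum_repr (v i)).symm]
    rw [f.map_sum]
    simp only [f.map_smul_univ]
  rw [h]
  have hb (j) : Continuous (b.coord j) := (b.coord j).continuous_of_finiteDimensional
  fun_prop

variable {E : Type*} [NormedAddCommGroup E] [NormedSpace ℝ E] [FiniteDimensional ℝ E]
  {G : Type*} [TopologicalSpace G] [T2Space G] [ChartedSpace E G] [Group G]
  [LieGroup 𝓘(ℝ, E) ∞ G] (Γ : Subgroup G) [DiscreteTopology Γ] {n : ℕ}

/-- The form `η` on `Γ\G` is induced by the left invariant form on `G` whose value on the Lie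
algebra of `G` is `σ`. -/
def LeftQuotient.IsInducedForm (σ : E [⋀^Fin n]→L[ℝ] ℂ) (η : ComplexForm E (LeftQuotient Γ) n) :
    Prop :=
  ∀ (g : G) (v : Fin n → GroupLieAlgebra 𝓘(ℝ, E) G),
      η (LeftQuotient.mk Γ g) (fun i ↦ mfderiv 𝓘(ℝ, E) 𝓘(ℝ, E) (LeftQuotient.mk Γ) g
        (mulInvariantVectorField (v i) g)) = σ v

/-- The form is transported from 1 along h ↦ Γgh. This map, hence its differential `P g`, depends
only on the coset Γg, so the choice of representative is harmless. -/
theorem LeftQuotient.exists_isInducedForm (σ : E [⋀^Fin n]→L[ℝ] ℂ) :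
    ∃ η : ComplexForm E (LeftQuotient Γ) n, LeftQuotient.IsInducedForm Γ σ η := by
  choose P hP hPv using LeftQuotient.mfderiv_mk_mulInvariantVectorField (E := E) Γ
  choose r hr using LeftQuotient.mk_surjective Γ
  have hrP (g : G) : P (r (LeftQuotient.mk Γ g)) = P g := by
    obtain ⟨γ, hγ, e⟩ := LeftQuotient.mk_eq_mk_iff.1 (hr (LeftQuotient.mk Γ g))
    apply ContinuousLinearEquiv.coe_injective
    rw [hP, hP]
    have : (fun h ↦ LeftQuotient.mk Γ (r (LeftQuotient.mk Γ g) * h)) =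
        fun h ↦ LeftQuotient.mk Γ (g * h) := by
      funext h
      exact LeftQuotient.mk_eq_mk_iff.2 ⟨γ, hγ, by rw [← e, mul_assoc]⟩
    rw [this]
  refine ⟨fun x ↦ σ.compContinuousLinearMap ((P (r x)).symm : E →L[ℝ] E), fun g v ↦ ?_⟩
  change σ (fun i ↦ (P (r (LeftQuotient.mk Γ g))).symm _) = σ v
  rw [hrP]
  exact congrArg σ (funext fun i ↦ (P g).symm_apply_eq.2 (hPv g (v i)))

variable {Γ} {σ : E [⋀^Fin n]→L[ℝ] ℂ} {η : ComplexForm E (LeftQuotient Γ) n}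

variable (Γ) in
theorem LeftQuotient.exists_extChartAt_symm_eq (x₀ : LeftQuotient Γ) : ∃ g₀ : G,
    (extChartAt 𝓘(ℝ, E) x₀).target ⊆ (extChartAt 𝓘(ℝ, E) g₀).target ∧
    ((extChartAt 𝓘(ℝ, E) x₀).symm : E → LeftQuotient Γ) =
      LeftQuotient.mk Γ ∘ (extChartAt 𝓘(ℝ, E) g₀).symm := by
  refine ⟨Classical.choose (LeftQuotient.mk_surjective Γ).hasRightInverse x₀, ?_, ?_⟩
  · intro y hy
    rw [extChartAt_target] at hy ⊢
    exact ⟨hy.1.1, hy.2⟩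
  · funext z
    exact congrFun ((LeftQuotient.isLocalHomeomorph_mk E Γ).localInverseAt_symm
      (x := Classical.choose (LeftQuotient.mk_surjective Γ).hasRightInverse x₀)) _

theorem LeftQuotient.exists_mfderiv_mk_eq (g : G) (w : TangentSpace 𝓘(ℝ, E) (LeftQuotient.mk Γ g)) :
    ∃ v : GroupLieAlgebra 𝓘(ℝ, E) G, mfderiv 𝓘(ℝ, E) 𝓘(ℝ, E) (LeftQuotient.mk Γ) g
        (mulInvariantVectorField v g) = w := by
  obtain ⟨P, -, hP⟩ := LeftQuotient.mfderiv_mk_mulInvariantVectorField (E := E) Γ g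
  exact ⟨P.symm (w : E), (hP _).trans (P.apply_symm_apply (w : E))⟩

theorem ComplexForm.inChart_eq_compContinuousLinearMap
    (hη : LeftQuotient.IsInducedForm Γ σ η) {x₀ : LeftQuotient Γ} {g₀ : G}
    (hsymm : ((extChartAt 𝓘(ℝ, E) x₀).symm : E → LeftQuotient Γ) =
      LeftQuotient.mk Γ ∘ (extChartAt 𝓘(ℝ, E) g₀).symm) {y : E}
    (hy : y ∈ (extChartAt 𝓘(ℝ, E) g₀).target) :
    η.inChart x₀ y = σ.compContinuousLinearMap (maurerCartanInChart g₀ y) := by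
  ext u
  change η ((extChartAt 𝓘(ℝ, E) x₀).symm y)
    (fun i ↦ mfderiv 𝓘(ℝ, E) 𝓘(ℝ, E) (extChartAt 𝓘(ℝ, E) x₀).symm y (u i)) = _
  rw [hsymm]
  refine Eq.trans ?_ (hη ((extChartAt 𝓘(ℝ, E) g₀).symm y)
    fun i ↦ maurerCartanInChart (E := E) g₀ y (u i))
  congr 1
  funext i
  have hn : (∞ : ℕ∞ω) ≠ 0 := by simp
  refine (mfderiv_comp_apply (I := 𝓘(ℝ, E)) (I' := 𝓘(ℝ, E)) (I'' := 𝓘(ℝ, E)) y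
    ((LeftQuotient.isLocalDiffeomorph_mk (E := E) Γ _).mdifferentiableAt hn)
    ((contMDiffAt_extChartAt_symm hy).mdifferentiableAt hn) (u i)).trans ?_
  congr 1
  exact mfderiv_extChartAt_symm_apply hy (u i)

theorem ComplexForm.isSmooth_of_isInducedForm
    (hη : LeftQuotient.IsInducedForm Γ σ η) : η.IsSmooth := by
  intro x₀
  obtain ⟨g₀, hsub, hsymm⟩ := LeftQuotient.exists_extChartAt_symm_eq (E := E) Γ x₀
  refine ContDiffOn.congr ?_ fun y hy ↦ η.inChart_eq_compContinuousLinearMap hη hsymm (hsub hy)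
  refine contDiffOn_continuousAlternatingMap_of_apply fun w ↦ ?_
  have hC := (contDiffOn_maurerCartanInChart g₀).mono hsub
  exact σ.toContinuousMultilinearMap.contDiff.comp_contDiffOn
    (contDiffOn_pi.2 fun i ↦ hC.clm_apply contDiffOn_const)

/-- Every tangent vector in the chart is the value of an invariant field, by the Maurer-Cartan form,
and `η` is constant on such fields. So its exterior derivative is the Chevalley-Eilenberg
differential of `σ'`. -/
theorem ComplexForm.d_eq_zero_of_isInducedForm
    (hη : LeftQuotient.IsInducedForm Γ σ η)
    (σ' : GroupLieAlgebra 𝓘(ℝ, E) G [⋀^Fin n]→ₗ[ℝ] ℂ) (hσ : ∀ v, σ' v = σ v)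
    (hd : ∀ v, lieFormDifferential σ' v = 0) (x : LeftQuotient Γ) : η.d x = 0 := by
  obtain ⟨g₀, hsub, hsymm⟩ := LeftQuotient.exists_extChartAt_symm_eq (E := E) Γ x
  have hx := mem_extChartAt_target (I := 𝓘(ℝ, E)) x
  set y := extChartAt 𝓘(ℝ, E) x x
  have hopen := (isOpen_extChartAt_target (I := 𝓘(ℝ, E)) x).mem_nhds hx
  have h0 : extDeriv (η.inChart x) y = 0 := by
    ext u
    have h := extDeriv_apply_eq_lieFormDifferential (𝔤 := GroupLieAlgebra 𝓘(ℝ, E) G) (σ := σ')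
      (η := η.inChart x) (X := invariantFieldInChart g₀) (y := y)
      (((η.isSmooth_of_isInducedForm hη x).contDiffAt hopen).differentiableAt (by simp))
      (differentiableAt_invariantFieldInChart (hsub hx))
      (lieBracket_invariantFieldInChart (hsub hx))
      (by
        filter_upwards [hopen] with z hz v
        rw [η.inChart_eq_compContinuousLinearMap hη hsymm (hsub hz), hσ]
        exact congrArg σ (funext fun i ↦
          maurerCartanInChart_invariantFieldInChart (hsub hz) (v i)))
      (fun i ↦ maurerCartanInChart (E := E) g₀ y (u i))
    refine Eq.trans (congrArg _ (funext fun i ↦ ?_)) (h.trans (hd _))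
    exact (invariantFieldInChart_maurerCartanInChart (hsub hx) (u i)).symm
  change (extDeriv (η.inChart x) y).compContinuousLinearMap _ = 0
  rw [h0]
  rfl

theorem ComplexForm.hasTypeKZero_of_isInducedForm
    (hη : LeftQuotient.IsInducedForm Γ σ η)
    {J : GroupLieAlgebra 𝓘(ℝ, E) G →ₗ[ℝ] GroupLieAlgebra 𝓘(ℝ, E) G}
    {JM : ∀ x : LeftQuotient Γ, TangentSpace 𝓘(ℝ, E) x →L[ℝ] TangentSpace 𝓘(ℝ, E) x}
    (hJM : LeftQuotient.IsInducedComplexStructure Γ J JM)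
    (hσ : IsTypeKZero J (fun v : Fin n → GroupLieAlgebra 𝓘(ℝ, E) G ↦ σ v)) :
    η.HasTypeKZero JM := by
  intro x w i
  obtain ⟨g, rfl⟩ := LeftQuotient.mk_surjective Γ x
  choose v hv using fun i ↦ LeftQuotient.exists_mfderiv_mk_eq g (w i)
  obtain rfl : (fun i ↦ mfderiv 𝓘(ℝ, E) 𝓘(ℝ, E) (LeftQuotient.mk Γ) g
    (mulInvariantVectorField (v i) g)) = w := funext hv
  refine Eq.trans ?_ ((hη g _).trans ((hσ v i).trans (congrArg (Complex.I * ·) (hη g v).symm)))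
  congr 1
  funext j
  by_cases hj : j = i
  · subst hj
    rw [Function.update_self, Function.update_self]
    exact hJM g (v j)
  · rw [Function.update_of_ne hj, Function.update_of_ne hj]

/-- If the Lie algebra of `G` is unimodular and `J` is abelian, then `Γ\G` has a nowhere vanishing
holomorphic `(n, 0)`-form. -/
theorem LeftQuotient.hasTrivialCanonicalBundle_of_isUnimodular
    {J : GroupLieAlgebra 𝓘(ℝ, E) G →ₗ[ℝ] GroupLieAlgebra 𝓘(ℝ, E) G}
    {JM : ∀ x : LeftQuotient Γ, TangentSpace 𝓘(ℝ, E) x →L[ℝ] TangentSpace 𝓘(ℝ, E) x}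
    (hn : Module.finrank ℝ E = 2 * n) (hJ : IsAbelianComplexStructure J)
    (hJM : LeftQuotient.IsInducedComplexStructure Γ J JM)
    (hG : IsUnimodularLieAlgebra (GroupLieAlgebra 𝓘(ℝ, E) G)) :
    HasTrivialCanonicalBundle JM n := by
  have : FiniteDimensional ℝ (GroupLieAlgebra 𝓘(ℝ, E) G) := inferInstanceAs (FiniteDimensional ℝ E)
  obtain ⟨σ', hσ0, hσJ, hσd⟩ := (exists_closed_form_iff_isUnimodularLieAlgebra J hn hJ).2 hG
  let σ : E [⋀^Fin n]→L[ℝ] ℂ :=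
    { toMultilinearMap := σ'.toMultilinearMap
      map_eq_zero_of_eq' := σ'.map_eq_zero_of_eq'
      cont := MultilinearMap.continuous_of_finiteDimensional (E := E) σ'.toMultilinearMap }
  have hσ (v : Fin n → E) : σ' v = σ v := rfl
  obtain ⟨η, hη⟩ := LeftQuotient.exists_isInducedForm Γ σ
  refine ⟨η, ⟨η.isSmooth_of_isInducedForm hη, η.hasTypeKZero_of_isInducedForm hη hJM ?_, ?_⟩, ?_⟩
  · intro v i
    exact (hσ _).symm.trans ((hσJ v i).trans (congrArg _ (hσ v)))
  · intro x v i
    rw [η.d_eq_zero_of_isInducedForm hη σ' hσ hσd]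
    simp
  · intro x hx
    obtain ⟨g, rfl⟩ := LeftQuotient.mk_surjective Γ x
    apply hσ0
    ext v
    refine (hσ v).trans ?_
    refine (hη g v).symm.trans ?_
    rw [hx]
    rfl

end InvariantForms

/-! ### Cocompact discrete subgroups and bi-invariance of Haar measure -/

section Lattices

open MeasureTheory

/-- A compact neighbourhood of 1 generates an open, hence closed, subgroup, which is everything by
connectedness. It is the union of the compact sets `L n` of n-fold products. -/
theorem IsTopologicalGroup.sigmaCompactSpace_of_preconnectedSpace (G : Type*) [Group G]
    [TopologicalSpace G] [IsTopologicalGroup G] [LocallyCompactSpace G] [PreconnectedSpace G] :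
    SigmaCompactSpace G := by
  obtain ⟨K, hK, hK1⟩ := exists_compact_mem_nhds (1 : G)
  let S : Set G := K ∪ K⁻¹
  have hS : IsCompact S := hK.union hK.inv
  let L (n : ℕ) : Set G := Nat.rec {1} (fun _ s ↦ Set.image2 (· * ·) s S) n
  have hL (n : ℕ) : IsCompact (L n) := by
    induction n with
    | zero => exact isCompact_singleton
    | succ n ih =>
      have := (IsCompact.prod ih hS).image continuous_mul
      rwa [Set.image_prod] at this
  have hsub (x : G) (hx : x ∈ Subgroup.closure K) : x ∈ ⋃ n, L n := by
    induction hx using Subgroup.closure_induction_right with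
    | one => exact Set.mem_iUnion.2 ⟨0, rfl⟩
    | mul_right x _ y hy ih =>
      obtain ⟨n, hn⟩ := Set.mem_iUnion.1 ih
      exact Set.mem_iUnion.2 ⟨n + 1, x, hn, y, Or.inl hy, rfl⟩
    | mul_inv_cancel x _ y hy ih =>
      obtain ⟨n, hn⟩ := Set.mem_iUnion.1 ih
      exact Set.mem_iUnion.2 ⟨n + 1, x, hn, y⁻¹, Or.inr (Set.inv_mem_inv.2 hy), rfl⟩
  have hopen : IsOpen (Subgroup.closure K : Set G) :=
    Subgroup.isOpen_of_mem_nhds _ (Filter.mem_of_superset hK1 Subgroup.subset_closure)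
  have htop : (Subgroup.closure K : Set G) = Set.univ :=
    IsClopen.eq_univ ⟨Subgroup.isClosed_of_isOpen _ hopen, hopen⟩ ⟨1, one_mem _⟩
  rw [← isSigmaCompact_univ_iff, ← Set.univ_subset_iff.1 (htop ▸ hsub : Set.univ ⊆ ⋃ n, L n)]
  exact isSigmaCompact_iUnion_of_isCompact L hL

/-- A cocompact discrete subgroup, acting with local homeomorphism to the quotient, has a
fundamental domain of finite measure. -/
theorem LeftQuotient.exists_isFundamentalDomain {G : Type*} [Group G] [TopologicalSpace G]
    [IsTopologicalGroup G] [LocallyCompactSpace G] [MeasurableSpace G] [BorelSpace G]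
    (μ : Measure G) [IsFiniteMeasureOnCompacts μ] (Γ : Subgroup G)
    [CompactSpace (LeftQuotient Γ)] (hΓ : IsLocalHomeomorph (LeftQuotient.mk Γ)) :
    ∃ F : Set G, IsFundamentalDomain Γ F μ ∧ μ F ≠ ⊤ := by
  have hV (x : G) : ∃ V : Set G, IsOpen V ∧ x ∈ V ∧ Set.InjOn (LeftQuotient.mk Γ) V ∧
      μ V ≠ ⊤ := by
    obtain ⟨K, hK, hxK⟩ := exists_compact_mem_nhds x
    obtain ⟨e, hxe, he⟩ := hΓ x
    refine ⟨e.source ∩ interior K, e.open_source.inter isOpen_interior,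
      ⟨hxe, mem_interior_iff_mem_nhds.2 hxK⟩, ?_, ?_⟩
    · rw [he]
      exact e.injOn.mono Set.inter_subset_left
    · exact ne_top_of_le_ne_top hK.measure_ne_top
        (measure_mono (Set.inter_subset_right.trans interior_subset))
  choose V hVo hxV hVi hVm using hV
  obtain ⟨t, ht⟩ := isCompact_univ.elim_finite_subcover (fun x ↦ LeftQuotient.mk Γ '' V x)
    (fun x ↦ hΓ.isOpenMap _ (hVo x)) (fun y _ ↦ by
      obtain ⟨x, rfl⟩ := LeftQuotient.mk_surjective Γ y
      exact Set.mem_iUnion.2 ⟨x, x, hxV x, rfl⟩)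
  let p : Fin t.card → G := fun i ↦ t.equivFin.symm i
  -- The saturations `W i` cover the group; removing the earlier ones makes the `D i` a Γ-invariant
  -- partition. Each orbit lies in one `D i` and meets the matching `V (p i)` exactly once, since
  -- the projection is injective there.
  let W (i : Fin t.card) : Set G := LeftQuotient.mk Γ ⁻¹' (LeftQuotient.mk Γ '' V (p i))
  let D (i : Fin t.card) : Set G := W i \ ⋃ j ∈ Set.Iio i, W j
  have hWo (i) : IsOpen (W i) := (hΓ.isOpenMap _ (hVo _)).preimage hΓ.continuous
  have hWΓ (i) (γ : Γ) (x : G) : γ • x ∈ W i ↔ x ∈ W i := by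
    have : LeftQuotient.mk Γ (γ • x) = LeftQuotient.mk Γ x :=
      LeftQuotient.mk_eq_mk_iff.2 ⟨γ, γ.2, rfl⟩
    simp only [W, Set.mem_preimage, this]
  have hDΓ (i) (γ : Γ) (x : G) : γ • x ∈ D i ↔ x ∈ D i := by
    simp only [D, Set.mem_sdiff, Set.mem_iUnion, hWΓ]
  have hDm (i) : MeasurableSet (D i) := (hWo i).measurableSet.diff
    (MeasurableSet.biUnion (Set.to_countable _) fun j _ ↦ (hWo j).measurableSet)
  have hDu (x : G) : ∃ i, x ∈ D i := by
    have hx : ∃ i, x ∈ W i := by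
      obtain ⟨y, hy, hxy⟩ := Set.mem_iUnion₂.1 (ht (Set.mem_univ (LeftQuotient.mk Γ x)))
      refine ⟨t.equivFin ⟨y, hy⟩, ?_⟩
      simpa [W, p] using hxy
    classical
    let s := Finset.univ.filter fun i ↦ x ∈ W i
    have hs : s.Nonempty := hx.imp fun i hi ↦ by simpa [s] using hi
    refine ⟨s.min' hs, by simpa [s] using s.min'_mem hs, fun h ↦ ?_⟩
    obtain ⟨j, hj, hxj⟩ := Set.mem_iUnion₂.1 h
    exact absurd (s.min'_le j (by simpa [s] using hxj)) (not_le.2 hj)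
  have hDd (x : G) (i j) (hi : x ∈ D i) (hj : x ∈ D j) : i = j := by
    rcases lt_trichotomy i j with h | h | h
    · exact absurd (Set.mem_biUnion (Set.mem_Iio.2 h) hi.1) hj.2
    · exact h
    · exact absurd (Set.mem_biUnion (Set.mem_Iio.2 h) hj.1) hi.2
  refine ⟨⋃ i, V (p i) ∩ D i, IsFundamentalDomain.mk' ?_ fun x ↦ ?_, ?_⟩
  · exact (MeasurableSet.iUnion fun i ↦ (hVo _).measurableSet.inter (hDm i)).nullMeasurableSet
  · obtain ⟨i, hi⟩ := hDu x
    obtain ⟨y, hy, hyx⟩ := hi.1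
    obtain ⟨γ, hγ, rfl⟩ := LeftQuotient.mk_eq_mk_iff.1 hyx
    refine ⟨⟨γ, hγ⟩, Set.mem_iUnion.2 ⟨i, hy, (hDΓ i ⟨γ, hγ⟩ x).2 hi⟩, fun δ hδ ↦ ?_⟩
    obtain ⟨j, hj, hδj⟩ := Set.mem_iUnion.1 hδ
    obtain rfl := hDd x i j hi ((hDΓ j δ x).1 hδj)
    have := hVi _ hj hy (LeftQuotient.mk_eq_mk_iff.2 ⟨δ * γ⁻¹, Γ.mul_mem δ.2 (Γ.inv_mem hγ),
      by simp [Subgroup.smul_def]⟩)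
    exact Subtype.ext (mul_right_cancel this)
  · refine ne_top_of_le_ne_top ?_ (measure_iUnion_le _)
    rw [tsum_fintype]
    exact (ENNReal.sum_lt_top.2 fun i _ ↦ (measure_mono Set.inter_subset_left).trans_lt
      (hVm _).lt_top).ne

/-- A group containing a cocompact discrete subgroup is unimodular: left Haar measures are right
invariant. -/
theorem LeftQuotient.isMulRightInvariant_of_compactSpace {G : Type*} [Group G]
    [TopologicalSpace G] [IsTopologicalGroup G] [LocallyCompactSpace G]
    [SecondCountableTopology G] [MeasurableSpace G] [BorelSpace G]
    (μ : Measure G) [μ.IsHaarMeasure] [μ.InnerRegular] (Γ : Subgroup G) [Countable Γ]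
    [CompactSpace (LeftQuotient Γ)] (hΓ : IsLocalHomeomorph (LeftQuotient.mk Γ)) :
    μ.IsMulRightInvariant := by
  obtain ⟨F, hF, hFm⟩ := LeftQuotient.exists_isFundamentalDomain μ Γ hΓ
  refine ⟨fun g ↦ ?_⟩
  have h := Measure.map_right_mul_eq_modularCharacterFun_smul μ g
  have hq : Measure.QuasiMeasurePreserving (· * g) μ μ :=
    ⟨measurable_mul_const g, by rw [h]; exact Measure.smul_absolutelyContinuous⟩
  -- Right translation commutes with the left action of Γ. Two fundamental domains have equal
  -- measure, and this measure is finite and nonzero, so the modular character can be cancelled to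
  -- 1.
  have hF' : IsFundamentalDomain Γ ((· * g) ⁻¹' F) μ :=
    hF.preimage_of_equiv hq Function.bijective_id fun γ x ↦ by
      simp [Subgroup.smul_def, mul_assoc]
  have e1 : μ ((· * g) ⁻¹' F) = Measure.modularCharacterFun g • μ F := by
    refine ((MeasurableEquiv.mulRight g).map_apply F).symm.trans ?_
    exact congrArg (fun ν : Measure G ↦ ν F) h
  have e2 := hF.measure_eq hF'
  have hF0 := hF.measure_ne_zero (NeZero.ne μ)
  have : Measure.modularCharacterFun g = 1 := by
    rw [e1, ENNReal.smul_def, smul_eq_mul] at e2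
    rw [← ENNReal.coe_inj, ENNReal.coe_one]
    exact ((ENNReal.mul_eq_right hF0 hFm).1 e2.symm)
  rw [h, this, one_smul]

end Lattices

/-! ### Integrals of derivatives along invariant fields -/

section InvariantIntegrals

open MeasureTheory

variable {E : Type*} [NormedAddCommGroup E] [NormedSpace ℝ E]
  {G : Type*} [TopologicalSpace G] [ChartedSpace E G]

/-- Differentiation under the integral sign; the common compact support for |t| ≤ 1 supplies a
bounded dominating function. -/
theorem integral_deriv_eq_zero_of_integral_eq [IsManifold 𝓘(ℝ, E) 1 G] [MeasurableSpace G]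
    [BorelSpace G] [T2Space G]
    [SecondCountableTopology G] (μ : Measure G) [IsFiniteMeasureOnCompacts μ] {H : ℝ × G → ℝ}
    (hH : ContMDiff (𝓘(ℝ, ℝ).prod 𝓘(ℝ, E)) 𝓘(ℝ, ℝ) ∞ H) {K : Set G} (hK : IsCompact K)
    (hHK : ∀ t ∈ Set.Icc (-1 : ℝ) 1, ∀ g ∉ K, H (t, g) = 0)
    (hint : ∀ t, ∫ g, H (t, g) ∂μ = ∫ g, H (0, g) ∂μ) :
    ∫ g, deriv (fun t ↦ H (t, g)) 0 ∂μ = 0 := by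
  have hdiff (g : G) : Differentiable ℝ fun t ↦ H (t, g) := by
    have : ContMDiff 𝓘(ℝ, ℝ) 𝓘(ℝ, ℝ) ∞ fun t ↦ H (t, g) :=
      hH.comp (contMDiff_id.prodMk contMDiff_const)
    exact this.contDiff.differentiable (by simp)
  have hcont : Continuous fun p : ℝ × G ↦ deriv (fun t ↦ H (t, p.2)) p.1 := by
    refine continuous_iff_continuousAt.2 fun p ↦ ?_
    have h1 : ContMDiffAt ((𝓘(ℝ, ℝ).prod 𝓘(ℝ, E)).prod 𝓘(ℝ, ℝ)) 𝓘(ℝ, ℝ) ∞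
        (Function.uncurry fun (p : ℝ × G) (t : ℝ) ↦ H (t, p.2)) (p, p.1) :=
      (hH.comp (contMDiff_snd.prodMk (contMDiff_snd.comp contMDiff_fst))).contMDiffAt
    have h2 := ContMDiffAt.mfderiv (m := 0) (n := ∞) _ (fun p : ℝ × G ↦ p.1) h1 contMDiffAt_fst
      (by simp)
    have h3 := h2.continuousAt.clm_apply (continuousAt_const (y := (1 : ℝ)))
    refine h3.congr (Filter.Eventually.of_forall fun q ↦ ?_)
    refine (congrArg (fun L : ℝ →L[ℝ] ℝ ↦ L 1) (congrFun (inTangentCoordinates_model_space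
      (I := 𝓘(ℝ, ℝ)) (I' := 𝓘(ℝ, ℝ)) (fun p : ℝ × G ↦ p.1) _ _ _) q)).trans ?_
    exact (congrArg (fun L : ℝ →L[ℝ] ℝ ↦ L 1) mfderiv_eq_fderiv).trans fderiv_apply_one_eq_deriv
  obtain ⟨C, hC⟩ := ((isCompact_Icc (a := (-1 : ℝ)) (b := 1)).prod hK).exists_bound_of_continuousOn
    hcont.continuousOn
  have hHc (t : ℝ) : Continuous fun g ↦ H (t, g) := hH.continuous.comp (by fun_prop)
  have hderiv0 (t : ℝ) (ht : t ∈ Metric.ball (0 : ℝ) 1) (g : G) (hg : g ∉ K) :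
      deriv (fun t ↦ H (t, g)) t = 0 := by
    have : (fun t ↦ H (t, g)) =ᶠ[𝓝 t] fun _ ↦ 0 := by
      filter_upwards [Metric.isOpen_ball.mem_nhds ht] with s hs
      rw [Real.ball_eq_Ioo] at hs
      exact hHK s ⟨by linarith [hs.1], by linarith [hs.2]⟩ g hg
    rw [this.deriv_eq, deriv_const]
  have hmain := hasDerivAt_integral_of_dominated_loc_of_deriv_le (μ := μ)
    (F := fun t g ↦ H (t, g)) (F' := fun t g ↦ deriv (fun t ↦ H (t, g)) t) (x₀ := (0 : ℝ))
    (s := Metric.ball 0 1) (bound := K.indicator fun _ ↦ C) (Metric.ball_mem_nhds _ one_pos)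
    (Filter.Eventually.of_forall fun t ↦ (hHc t).aestronglyMeasurable)
    ((hHc 0).integrable_of_hasCompactSupport
      (HasCompactSupport.intro hK (hHK 0 (by simp))))
    (hcont.comp (by fun_prop : Continuous fun g : G ↦ ((0 : ℝ), g))).aestronglyMeasurable
    (Filter.Eventually.of_forall fun g t ht ↦ ?_)
    ((integrable_indicator_iff hK.measurableSet).2
      (integrableOn_const hK.measure_ne_top))
    (Filter.Eventually.of_forall fun g t _ ↦ (hdiff g t).hasDerivAt)
  · have hc : (fun t ↦ ∫ g, H (t, g) ∂μ) = fun _ ↦ ∫ g, H (0, g) ∂μ := funext hint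
    have h := hmain.2
    rw [hc] at h
    exact h.unique (hasDerivAt_const _ _)
  · by_cases hg : g ∈ K
    · rw [Set.indicator_of_mem hg]
      rw [Real.ball_eq_Ioo] at ht
      exact hC (t, g) ⟨⟨by linarith [ht.1], by linarith [ht.2]⟩, hg⟩
    · rw [Set.indicator_of_notMem hg, hderiv0 t ht g hg, norm_zero]

/-- The differential at `1` of a vector valued function on a Lie group. -/
noncomputable def derivAtOne [One G] {W : Type*} [NormedAddCommGroup W] [NormedSpace ℝ W]
    (F : G → W) : E →L[ℝ] W :=
  mfderiv 𝓘(ℝ, E) 𝓘(ℝ, W) F 1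

/-- A substitute for the exponential map: only the velocity at 0 matters, up to a nonzero factor.
The sine bounds a line segment in the chart, so the curve is smooth on all of ℝ without leaving the
chart. -/
theorem exists_contMDiff_curve [Group G] [LieGroup 𝓘(ℝ, E) ∞ G] (v : E) :
    ∃ (c : ℝ → G) (δ : ℝ), δ ≠ 0 ∧ ContMDiff 𝓘(ℝ, ℝ) 𝓘(ℝ, E) ∞ c ∧
      ∀ F : G → ℝ, MDifferentiableAt 𝓘(ℝ, E) 𝓘(ℝ, ℝ) F 1 →
        deriv (fun t ↦ F (c t)) 0 = δ * derivAtOne F v := by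
  set φ := extChartAt 𝓘(ℝ, E) (1 : G)
  have he : φ 1 ∈ φ.target := mem_extChartAt_target (I := 𝓘(ℝ, E)) (1 : G)
  have hφe : φ.symm (φ 1) = 1 := extChartAt_to_inv (I := 𝓘(ℝ, E)) (1 : G)
  let T : E →L[ℝ] E := mfderiv 𝓘(ℝ, E) 𝓘(ℝ, E) φ.symm (φ 1)
  have hT : T.IsInvertible := isInvertible_mfderiv_extChartAt_symm he
  obtain ⟨u, hu⟩ : ∃ u : E, T u = v := hT.surjective v
  obtain ⟨ε, hε, hball⟩ := Metric.mem_nhds_iff.1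
    ((isOpen_extChartAt_target (I := 𝓘(ℝ, E)) (1 : G)).mem_nhds he)
  let δ := ε / (2 * (‖u‖ + 1))
  have hδ : 0 < δ := by positivity
  let γ (t : ℝ) : E := φ 1 + (δ * Real.sin t) • u
  have hγ (t : ℝ) : γ t ∈ φ.target := by
    apply hball
    rw [Metric.mem_ball, dist_eq_norm, add_sub_cancel_left, norm_smul, norm_mul,
      Real.norm_of_nonneg hδ.le]
    calc δ * ‖Real.sin t‖ * ‖u‖ ≤ δ * 1 * (‖u‖ + 1) := by
          gcongr
          · exact Real.abs_sin_le_one t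
          · linarith
      _ = ε / 2 := by simp only [δ]; field_simp
      _ < ε := by linarith
  have hγs : ContDiff ℝ ∞ γ := by
    have := Real.contDiff_sin (n := ∞)
    fun_prop
  have hγ0 : γ 0 = φ 1 := by simp [γ]
  have hγ' : HasDerivAt γ (δ • u) 0 := by
    have := (((Real.hasDerivAt_sin 0).const_mul δ).smul_const u).const_add (φ 1)
    simpa [γ] using this
  refine ⟨φ.symm ∘ γ, δ, hδ.ne',
    (contMDiffOn_extChartAt_symm 1).comp_contMDiff hγs.contMDiff hγ, fun F hF ↦ ?_⟩
  have h1 : HasMFDerivAt 𝓘(ℝ, E) 𝓘(ℝ, E) φ.symm (φ 1) T :=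
    ((contMDiffAt_extChartAt_symm he).mdifferentiableAt (by simp)).hasMFDerivAt
  have h2 : HasFDerivAt (F ∘ φ.symm) ((derivAtOne F).comp T) (φ 1) := by
    have hF' : HasMFDerivAt 𝓘(ℝ, E) 𝓘(ℝ, ℝ) F (φ.symm (φ 1)) (derivAtOne (E := E) F) := by
      rw [hφe]; exact hF.hasMFDerivAt
    exact (hF'.comp (φ 1) h1).hasFDerivAt
  rw [← hγ0] at h2
  refine (h2.comp_hasDerivAt 0 hγ').deriv.trans ?_
  rw [ContinuousLinearMap.comp_apply, map_smul, hu, map_smul, smul_eq_mul]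

variable [Group G] [LieGroup 𝓘(ℝ, E) ∞ G] [MeasurableSpace G] [BorelSpace G] [T2Space G]
    [SecondCountableTopology G] (μ : Measure G) [IsFiniteMeasureOnCompacts μ]

/-- The integral of the derivative of a test function along a left invariant vector field against a
right invariant measure vanishes. -/
theorem integral_derivAtOne_mul_left_eq_zero [μ.IsMulRightInvariant] {f : G → ℝ}
    (hf : ContMDiff 𝓘(ℝ, E) 𝓘(ℝ, ℝ) ∞ f) (hfc : HasCompactSupport f) (v : E) :
    ∫ g, derivAtOne (fun h ↦ f (g * h)) v ∂μ = 0 := by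
  have : IsTopologicalGroup G := topologicalGroup_of_lieGroup 𝓘(ℝ, E) ∞
  obtain ⟨c, δ, hδ, hc, hcd⟩ := exists_contMDiff_curve (G := G) v
  -- This compact set contains the supports of all translates g ↦ f(g c(t)) with |t| ≤ 1.
  have hK : IsCompact ((fun p : G × ℝ ↦ p.1 * (c p.2)⁻¹) '' (tsupport f ×ˢ Set.Icc (-1) 1)) :=
    (hfc.isCompact.prod isCompact_Icc).image (by have := hc.continuous; fun_prop)
  have h := integral_deriv_eq_zero_of_integral_eq μ (H := fun p : ℝ × G ↦ f (p.2 * c p.1))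
    (hf.comp (contMDiff_snd.mul (hc.comp contMDiff_fst))) hK
    (fun t ht g hg ↦ by
      by_contra hne
      exact hg ⟨(g * c t, t), ⟨subset_tsupport _ hne, ht⟩, by simp⟩)
    (fun t ↦ (integral_mul_right_eq_self (fun g ↦ f g) (c t)).trans
      (integral_mul_right_eq_self (fun g ↦ f g) (c 0)).symm)
  simp only [fun g : G ↦ hcd (fun h ↦ f (g * h))
    ((hf.comp contMDiff_mul_left).contMDiffAt.mdifferentiableAt (by simp))] at h
  rw [integral_const_mul] at h
  exact (mul_eq_zero.1 h).resolve_left hδ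

/-- The integral of the derivative of a test function along a right invariant vector field against
a left invariant measure vanishes. -/
theorem integral_derivAtOne_mul_right_eq_zero [μ.IsMulLeftInvariant] {f : G → ℝ}
    (hf : ContMDiff 𝓘(ℝ, E) 𝓘(ℝ, ℝ) ∞ f) (hfc : HasCompactSupport f) (v : E) :
    ∫ g, derivAtOne (fun h ↦ f (h * g)) v ∂μ = 0 := by
  have : IsTopologicalGroup G := topologicalGroup_of_lieGroup 𝓘(ℝ, E) ∞
  obtain ⟨c, δ, hδ, hc, hcd⟩ := exists_contMDiff_curve (G := G) v
  have hK : IsCompact ((fun p : G × ℝ ↦ (c p.2)⁻¹ * p.1) '' (tsupport f ×ˢ Set.Icc (-1) 1)) :=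
    (hfc.isCompact.prod isCompact_Icc).image (by have := hc.continuous; fun_prop)
  have h := integral_deriv_eq_zero_of_integral_eq μ (H := fun p : ℝ × G ↦ f (c p.1 * p.2))
    (hf.comp ((hc.comp contMDiff_fst).mul contMDiff_snd)) hK
    (fun t ht g hg ↦ by
      by_contra hne
      exact hg ⟨(c t * g, t), ⟨subset_tsupport _ hne, ht⟩, by simp⟩)
    (fun t ↦ (integral_mul_left_eq_self (fun g ↦ f g) (c t)).trans
      (integral_mul_left_eq_self (fun g ↦ f g) (c 0)).symm)
  simp only [fun g : G ↦ hcd (fun h ↦ f (h * g))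
    ((hf.comp contMDiff_mul_right).contMDiffAt.mdifferentiableAt (by simp))] at h
  rw [integral_const_mul] at h
  exact (mul_eq_zero.1 h).resolve_left hδ

end InvariantIntegrals

/-! ### The adjoint representation -/

section AdjointRepresentation

variable {E : Type*} [NormedAddCommGroup E] [NormedSpace ℝ E]
  {G : Type*} [TopologicalSpace G] [ChartedSpace E G] [Group G]

/-- The adjoint representation of a Lie group, on the model space of its tangent spaces. -/
noncomputable def lieGroupAd (g : G) : E →L[ℝ] E :=
  mfderiv 𝓘(ℝ, E) 𝓘(ℝ, E) (fun h ↦ g * h * g⁻¹) 1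

theorem lieGroupAd_one : lieGroupAd (E := E) (1 : G) = ContinuousLinearMap.id ℝ E := by
  have : (fun h : G ↦ 1 * h * 1⁻¹) = id := by funext h; simp
  rw [lieGroupAd, this]
  exact mfderiv_id

theorem inTangentCoordinates_vectorSpace_eq_self {W M N : Type*} [NormedAddCommGroup W]
    [NormedSpace ℝ W] [TopologicalSpace M] [ChartedSpace E M] [IsManifold 𝓘(ℝ, E) 1 M]
    {f : N → M} {g : N → W} {ϕ : N → E →L[ℝ] W} {x₀ x : N} (hf : f x = f x₀) :
    inTangentCoordinates 𝓘(ℝ, E) 𝓘(ℝ, W) f g ϕ x₀ x = ϕ x := by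
  rw [inTangentCoordinates_eq _ _ _ (by rw [hf]; exact mem_chart_source _ _) (Set.mem_univ _), hf]
  ext u
  simp only [ContinuousLinearMap.comp_apply]
  rw [(tangentBundleCore 𝓘(ℝ, E) M).coordChange_self _ _ (mem_chart_source E (f x₀))]
  simp

theorem inTangentCoordinates_eq_self_of_eq {M M' N : Type*} [TopologicalSpace M]
    [ChartedSpace E M] [IsManifold 𝓘(ℝ, E) 1 M] [TopologicalSpace M'] [ChartedSpace E M']
    [IsManifold 𝓘(ℝ, E) 1 M'] {f : N → M} {g : N → M'} {ϕ : N → E →L[ℝ] E} {x₀ x : N}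
    (hf : f x = f x₀) (hg : g x = g x₀) :
    inTangentCoordinates 𝓘(ℝ, E) 𝓘(ℝ, E) f g ϕ x₀ x = ϕ x := by
  rw [inTangentCoordinates_eq _ _ _ (by rw [hf]; exact mem_chart_source _ _)
    (by rw [hg]; exact mem_chart_source _ _), hf, hg]
  ext u
  simp only [ContinuousLinearMap.comp_apply]
  rw [(tangentBundleCore 𝓘(ℝ, E) M).coordChange_self _ _ (mem_chart_source E (f x₀)),
    (tangentBundleCore 𝓘(ℝ, E) M').coordChange_self _ _ (mem_chart_source E (g x₀))]

variable [LieGroup 𝓘(ℝ, E) ∞ G]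

theorem contMDiff_lieGroupAd :
    ContMDiff 𝓘(ℝ, E) 𝓘(ℝ, E →L[ℝ] E) ∞ (lieGroupAd (E := E) (G := G)) := by
  intro g
  have h1 : ContMDiffAt (𝓘(ℝ, E).prod 𝓘(ℝ, E)) 𝓘(ℝ, E) ∞
      (Function.uncurry fun g h : G ↦ g * h * g⁻¹) (g, 1) :=
    ((contMDiff_fst.mul contMDiff_snd).mul contMDiff_fst.inv).contMDiffAt
  have h2 := ContMDiffAt.mfderiv (m := ∞) (n := ∞) _ (fun _ : G ↦ (1 : G)) h1 contMDiffAt_const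
    le_rfl
  have h3 (x : G) : lieGroupAd (E := E) x = inTangentCoordinates 𝓘(ℝ, E) 𝓘(ℝ, E)
      (fun _ : G ↦ (1 : G)) (fun x : G ↦ x * 1 * x⁻¹) (lieGroupAd (E := E)) g x := by
    refine (inTangentCoordinates_eq_self_of_eq ?_ ?_).symm
    · rfl
    · simp
  refine h2.congr_of_eventuallyEq (Filter.Eventually.of_forall fun x ↦ ?_)
  refine (h3 x).trans ?_
  rfl

theorem continuous_derivAtOne_mul_right {a : G → ℝ} (ha : ContMDiff 𝓘(ℝ, E) 𝓘(ℝ, ℝ) ∞ a) (v : E) :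
    Continuous fun g ↦ derivAtOne (fun h ↦ a (h * g)) v := by
  refine continuous_iff_continuousAt.2 fun g ↦ ?_
  have h1 : ContMDiffAt (𝓘(ℝ, E).prod 𝓘(ℝ, E)) 𝓘(ℝ, ℝ) ∞
      (Function.uncurry fun g h : G ↦ a (h * g)) (g, 1) :=
    (ha.comp (contMDiff_snd.mul contMDiff_fst)).contMDiffAt
  have h2 := ContMDiffAt.mfderiv (m := 0) (n := ∞) _ (fun _ : G ↦ (1 : G)) h1 contMDiffAt_const
    (by simp)
  have h3 (x : G) : derivAtOne (E := E) (fun h : G ↦ a (h * x)) =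
      inTangentCoordinates 𝓘(ℝ, E) 𝓘(ℝ, ℝ) (fun _ : G ↦ (1 : G)) (fun x : G ↦ a (1 * x))
        (fun x ↦ derivAtOne (E := E) fun h : G ↦ a (h * x)) g x := by
    refine Eq.symm ?_
    apply inTangentCoordinates_vectorSpace_eq_self (M := G) (N := G) (f := fun _ ↦ 1)
      (g := fun x : G ↦ a (1 * x)) (x₀ := g)
    rfl
  have h4 : ContMDiffAt 𝓘(ℝ, E) 𝓘(ℝ, E →L[ℝ] ℝ) 0
      (fun g ↦ derivAtOne (E := E) fun h : G ↦ a (h * g)) g := by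
    refine h2.congr_of_eventuallyEq (Filter.Eventually.of_forall fun x ↦ ?_)
    refine (h3 x).trans ?_
    rfl
  exact h4.continuousAt.clm_apply continuousAt_const

/-- Differentiate gh = (g h g⁻¹) g at h = 1. -/
theorem mfderiv_mul_left_eq_mfderiv_mul_right_lieGroupAd (g : G) (v : E) :
    (mfderiv 𝓘(ℝ, E) 𝓘(ℝ, E) (fun h : G ↦ g * h) 1 : E →L[ℝ] E) v =
      (mfderiv 𝓘(ℝ, E) 𝓘(ℝ, E) (fun h : G ↦ h * g) 1 : E →L[ℝ] E) (lieGroupAd (E := E) g v) := by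
  have h1 : MDifferentiableAt 𝓘(ℝ, E) 𝓘(ℝ, E) (fun h ↦ g * h * g⁻¹) 1 :=
    (contMDiff_mul_right.comp contMDiff_mul_left).contMDiffAt.mdifferentiableAt
      (n := ∞) (by simp)
  have h2 : MDifferentiableAt 𝓘(ℝ, E) 𝓘(ℝ, E) (fun h ↦ h * g) (g * 1 * g⁻¹) :=
    contMDiff_mul_right.contMDiffAt.mdifferentiableAt (n := ∞) (by simp)
  have h3 := mfderiv_comp_apply (I := 𝓘(ℝ, E)) (I' := 𝓘(ℝ, E)) (I'' := 𝓘(ℝ, E)) 1 h2 h1 v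
  have h4 : (fun h ↦ h * g) ∘ (fun h ↦ g * h * g⁻¹) = fun h ↦ g * h := by
    funext h; simp
  rw [h4] at h3
  refine h3.trans ?_
  rw [mul_one, mul_inv_cancel]
  rfl

theorem derivAtOne_mul_left_eq {f : G → ℝ} (hf : ContMDiff 𝓘(ℝ, E) 𝓘(ℝ, ℝ) ∞ f) (g : G) (v : E) :
    derivAtOne (fun h ↦ f (g * h)) v =
      derivAtOne (fun h ↦ f (h * g)) (lieGroupAd (E := E) g v) := by
  have h1 : MDifferentiableAt 𝓘(ℝ, E) 𝓘(ℝ, E) (fun h ↦ g * h) 1 :=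
    contMDiff_mul_left.contMDiffAt.mdifferentiableAt (n := ∞) (by simp)
  have h2 : MDifferentiableAt 𝓘(ℝ, E) 𝓘(ℝ, E) (fun h ↦ h * g) 1 :=
    contMDiff_mul_right.contMDiffAt.mdifferentiableAt (n := ∞) (by simp)
  have h3 (x : G) : MDifferentiableAt 𝓘(ℝ, E) 𝓘(ℝ, ℝ) f x :=
    hf.contMDiffAt.mdifferentiableAt (by simp)
  have e1 := mfderiv_comp_apply (I := 𝓘(ℝ, E)) (I' := 𝓘(ℝ, E)) (I'' := 𝓘(ℝ, ℝ)) 1 (h3 _) h1 v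
  have e2 := mfderiv_comp_apply (I := 𝓘(ℝ, E)) (I' := 𝓘(ℝ, E)) (I'' := 𝓘(ℝ, ℝ)) 1 (h3 _) h2
    (lieGroupAd (E := E) g v)
  refine e1.trans (Eq.trans ?_ e2.symm)
  rw [mul_one, one_mul]
  exact congrArg _ (mfderiv_mul_left_eq_mfderiv_mul_right_lieGroupAd g v)

end AdjointRepresentation

/-! ### Multiplication in the chart at the identity -/

section AdjointDerivative

variable {E : Type*} [NormedAddCommGroup E] [NormedSpace ℝ E]
  {G : Type*} [TopologicalSpace G] [ChartedSpace E G] [Group G]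

variable (E G) in
/-- The multiplication of a Lie group in the preferred chart at `1`. -/
noncomputable def mulInChartOne (p : E × E) : E :=
  extChartAt 𝓘(ℝ, E) (1 : G)
    ((extChartAt 𝓘(ℝ, E) (1 : G)).symm p.1 * (extChartAt 𝓘(ℝ, E) (1 : G)).symm p.2)

theorem mulInChartOne_right {x : E} (hx : x ∈ (extChartAt 𝓘(ℝ, E) (1 : G)).target) :
    mulInChartOne E G (x, extChartAt 𝓘(ℝ, E) (1 : G) 1) = x := by
  rw [mulInChartOne, extChartAt_to_inv, mul_one, PartialEquiv.right_inv _ hx]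

theorem mulInChartOne_left {x : E} (hx : x ∈ (extChartAt 𝓘(ℝ, E) (1 : G)).target) :
    mulInChartOne E G (extChartAt 𝓘(ℝ, E) (1 : G) 1, x) = x := by
  rw [mulInChartOne, extChartAt_to_inv, one_mul, PartialEquiv.right_inv _ hx]

variable [LieGroup 𝓘(ℝ, E) ∞ G]

theorem contDiffAt_mulInChartOne {p : E × E} (h1 : p.1 ∈ (extChartAt 𝓘(ℝ, E) (1 : G)).target)
    (h2 : p.2 ∈ (extChartAt 𝓘(ℝ, E) (1 : G)).target)
    (h3 : (extChartAt 𝓘(ℝ, E) (1 : G)).symm p.1 * (extChartAt 𝓘(ℝ, E) (1 : G)).symm p.2 ∈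
      (chartAt E (1 : G)).source) : ContDiffAt ℝ ∞ (mulInChartOne E G) p := by
  have e1 : ContMDiffAt 𝓘(ℝ, E × E) 𝓘(ℝ, E) ∞
      (fun q : E × E ↦ (extChartAt 𝓘(ℝ, E) (1 : G)).symm q.1) p :=
    ContMDiffAt.comp p (contMDiffAt_extChartAt_symm h1) contDiff_fst.contMDiff.contMDiffAt
  have e2 : ContMDiffAt 𝓘(ℝ, E × E) 𝓘(ℝ, E) ∞
      (fun q : E × E ↦ (extChartAt 𝓘(ℝ, E) (1 : G)).symm q.2) p :=
    ContMDiffAt.comp p (contMDiffAt_extChartAt_symm h2) contDiff_snd.contMDiff.contMDiffAt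
  exact (ContMDiffAt.comp p (contMDiffAt_extChartAt' h3) (e1.mul e2)).contDiffAt

theorem mfderiv_extChartAt_symm_fderiv {f : E → E} {L : G → G} {x y : E}
    (hx : x ∈ (extChartAt 𝓘(ℝ, E) (1 : G)).target) (hy : y ∈ (extChartAt 𝓘(ℝ, E) (1 : G)).target)
    (hf : DifferentiableAt ℝ f y) (hfy : f y = x)
    (hL : MDifferentiableAt 𝓘(ℝ, E) 𝓘(ℝ, E) L ((extChartAt 𝓘(ℝ, E) (1 : G)).symm y))
    (h : ∀ᶠ z in 𝓝 y, (extChartAt 𝓘(ℝ, E) (1 : G)).symm (f z) =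
      L ((extChartAt 𝓘(ℝ, E) (1 : G)).symm z)) (u : E) :
    (mfderiv 𝓘(ℝ, E) 𝓘(ℝ, E) (extChartAt 𝓘(ℝ, E) (1 : G)).symm x : E →L[ℝ] E) (fderiv ℝ f y u) =
      (mfderiv 𝓘(ℝ, E) 𝓘(ℝ, E) L ((extChartAt 𝓘(ℝ, E) (1 : G)).symm y) : E →L[ℝ] E)
        ((mfderiv 𝓘(ℝ, E) 𝓘(ℝ, E) (extChartAt 𝓘(ℝ, E) (1 : G)).symm y : E →L[ℝ] E) u) := by
  have hn : (∞ : ℕ∞ω) ≠ 0 := by simp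
  subst hfy
  have h1 := ((contMDiffAt_extChartAt_symm hx).mdifferentiableAt hn).hasMFDerivAt.comp y
    hf.hasFDerivAt.hasMFDerivAt
  have h2 := hL.hasMFDerivAt.comp y
    ((contMDiffAt_extChartAt_symm hy).mdifferentiableAt hn).hasMFDerivAt
  have h3 := h1.congr_of_eventuallyEq (f₁ := L ∘ (extChartAt 𝓘(ℝ, E) (1 : G)).symm)
    (h.mono fun z hz ↦ hz.symm)
  exact congrArg (fun A : E →L[ℝ] E ↦ A u) (hasMFDerivAt_unique h3 h2)

theorem mfderiv_extChartAt_symm_fderiv_mulInChartOne_left {x : E}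
    (hx : x ∈ (extChartAt 𝓘(ℝ, E) (1 : G)).target) (u : E) :
    (mfderiv 𝓘(ℝ, E) 𝓘(ℝ, E) (extChartAt 𝓘(ℝ, E) (1 : G)).symm x : E →L[ℝ] E)
        (fderiv ℝ (mulInChartOne E G) (x, extChartAt 𝓘(ℝ, E) (1 : G) 1) (0, u)) =
      (mfderiv 𝓘(ℝ, E) 𝓘(ℝ, E) (fun h ↦ (extChartAt 𝓘(ℝ, E) (1 : G)).symm x * h) 1 : E →L[ℝ] E)
        ((mfderiv 𝓘(ℝ, E) 𝓘(ℝ, E) (extChartAt 𝓘(ℝ, E) (1 : G)).symm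
          (extChartAt 𝓘(ℝ, E) (1 : G) 1) : E →L[ℝ] E) u) := by
  have : IsTopologicalGroup G := topologicalGroup_of_lieGroup 𝓘(ℝ, E) ∞
  have hn : (∞ : ℕ∞ω) ≠ 0 := by simp
  have he : extChartAt 𝓘(ℝ, E) (1 : G) 1 ∈ (extChartAt 𝓘(ℝ, E) (1 : G)).target :=
    mem_extChartAt_target (I := 𝓘(ℝ, E)) (1 : G)
  have hs : (extChartAt 𝓘(ℝ, E) (1 : G)).symm x ∈ (extChartAt 𝓘(ℝ, E) (1 : G)).source :=
    (extChartAt 𝓘(ℝ, E) (1 : G)).map_target hx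
  have hm : DifferentiableAt ℝ (mulInChartOne E G) (x, extChartAt 𝓘(ℝ, E) (1 : G) 1) := by
    refine (contDiffAt_mulInChartOne hx he ?_).differentiableAt hn
    rw [extChartAt_to_inv, mul_one, ← extChartAt_source 𝓘(ℝ, E)]
    exact hs
  have hi : HasFDerivAt (fun z : E ↦ (x, z)) (ContinuousLinearMap.inr ℝ E E)
      (extChartAt 𝓘(ℝ, E) (1 : G) 1) := hasFDerivAt_prodMk_right _ _
  have hf := hm.hasFDerivAt.comp _ hi
  have key := mfderiv_extChartAt_symm_fderiv (G := G)
    (f := fun z ↦ mulInChartOne E G (x, z)) (L := fun h ↦ (extChartAt 𝓘(ℝ, E) (1 : G)).symm x * h)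
    hx he hf.differentiableAt (mulInChartOne_right hx)
    ((contMDiff_mul_left (n := ∞)).contMDiffAt.mdifferentiableAt hn) ?_ u
  · have hf' : fderiv ℝ (fun z ↦ mulInChartOne E G (x, z)) (extChartAt 𝓘(ℝ, E) (1 : G) 1) u =
        fderiv ℝ (mulInChartOne E G) (x, extChartAt 𝓘(ℝ, E) (1 : G) 1) (0, u) :=
      congrArg (fun A : E →L[ℝ] E ↦ A u) hf.fderiv
    rw [hf', extChartAt_to_inv] at key
    exact key
  · have hc : ContinuousAt (fun z ↦ (extChartAt 𝓘(ℝ, E) (1 : G)).symm x *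
        (extChartAt 𝓘(ℝ, E) (1 : G)).symm z) (extChartAt 𝓘(ℝ, E) (1 : G) 1) :=
      continuousAt_const.mul (continuousAt_extChartAt_symm (I := 𝓘(ℝ, E)) (1 : G))
    filter_upwards [hc.eventually_mem ((isOpen_extChartAt_source (I := 𝓘(ℝ, E)) (1 : G)).mem_nhds
      (by rwa [extChartAt_to_inv, mul_one]))] with z hz
    exact (extChartAt 𝓘(ℝ, E) (1 : G)).left_inv hz

theorem mfderiv_extChartAt_symm_fderiv_mulInChartOne_right {x : E}
    (hx : x ∈ (extChartAt 𝓘(ℝ, E) (1 : G)).target) (u : E) :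
    (mfderiv 𝓘(ℝ, E) 𝓘(ℝ, E) (extChartAt 𝓘(ℝ, E) (1 : G)).symm x : E →L[ℝ] E)
        (fderiv ℝ (mulInChartOne E G) (extChartAt 𝓘(ℝ, E) (1 : G) 1, x) (u, 0)) =
      (mfderiv 𝓘(ℝ, E) 𝓘(ℝ, E) (fun h ↦ h * (extChartAt 𝓘(ℝ, E) (1 : G)).symm x) 1 : E →L[ℝ] E)
        ((mfderiv 𝓘(ℝ, E) 𝓘(ℝ, E) (extChartAt 𝓘(ℝ, E) (1 : G)).symm
          (extChartAt 𝓘(ℝ, E) (1 : G) 1) : E →L[ℝ] E) u) := by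
  have : IsTopologicalGroup G := topologicalGroup_of_lieGroup 𝓘(ℝ, E) ∞
  have hn : (∞ : ℕ∞ω) ≠ 0 := by simp
  have he : extChartAt 𝓘(ℝ, E) (1 : G) 1 ∈ (extChartAt 𝓘(ℝ, E) (1 : G)).target :=
    mem_extChartAt_target (I := 𝓘(ℝ, E)) (1 : G)
  have hs : (extChartAt 𝓘(ℝ, E) (1 : G)).symm x ∈ (extChartAt 𝓘(ℝ, E) (1 : G)).source :=
    (extChartAt 𝓘(ℝ, E) (1 : G)).map_target hx
  have hm : DifferentiableAt ℝ (mulInChartOne E G) (extChartAt 𝓘(ℝ, E) (1 : G) 1, x) := by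
    refine (contDiffAt_mulInChartOne he hx ?_).differentiableAt hn
    rw [extChartAt_to_inv, one_mul, ← extChartAt_source 𝓘(ℝ, E)]
    exact hs
  have hi : HasFDerivAt (fun z : E ↦ (z, x)) (ContinuousLinearMap.inl ℝ E E)
      (extChartAt 𝓘(ℝ, E) (1 : G) 1) := hasFDerivAt_prodMk_left _ _
  have hf := HasFDerivAt.comp (f := fun z : E ↦ (z, x)) _ hm.hasFDerivAt hi
  have key := mfderiv_extChartAt_symm_fderiv (G := G)
    (f := fun z ↦ mulInChartOne E G (z, x)) (L := fun h ↦ h * (extChartAt 𝓘(ℝ, E) (1 : G)).symm x)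
    hx he hf.differentiableAt (mulInChartOne_left hx)
    ((contMDiff_mul_right (n := ∞)).contMDiffAt.mdifferentiableAt hn) ?_ u
  · have hf' : fderiv ℝ (fun z ↦ mulInChartOne E G (z, x)) (extChartAt 𝓘(ℝ, E) (1 : G) 1) u =
        fderiv ℝ (mulInChartOne E G) (extChartAt 𝓘(ℝ, E) (1 : G) 1, x) (u, 0) :=
      congrArg (fun A : E →L[ℝ] E ↦ A u) hf.fderiv
    rw [hf', extChartAt_to_inv] at key
    exact key
  · have hc : ContinuousAt (fun z ↦ (extChartAt 𝓘(ℝ, E) (1 : G)).symm z *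
        (extChartAt 𝓘(ℝ, E) (1 : G)).symm x) (extChartAt 𝓘(ℝ, E) (1 : G) 1) :=
      (continuousAt_extChartAt_symm (I := 𝓘(ℝ, E)) (1 : G)).mul continuousAt_const
    filter_upwards [hc.eventually_mem ((isOpen_extChartAt_source (I := 𝓘(ℝ, E)) (1 : G)).mem_nhds
      (by rwa [extChartAt_to_inv, one_mul]))] with z hz
    exact (extChartAt 𝓘(ℝ, E) (1 : G)).left_inv hz

/-- Makes the derivatives of left invariant fields at the identity mixed second derivatives of the
multiplication. -/
theorem fderiv_mulInChartOne_apply_zero_fst {x : E}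
    (hx : x ∈ (extChartAt 𝓘(ℝ, E) (1 : G)).target) (u : E) :
    fderiv ℝ (mulInChartOne E G) (x, extChartAt 𝓘(ℝ, E) (1 : G) 1) (0, u) =
      invariantFieldInChart (E := E) (1 : G) ((mfderiv 𝓘(ℝ, E) 𝓘(ℝ, E)
        (extChartAt 𝓘(ℝ, E) (1 : G)).symm (extChartAt 𝓘(ℝ, E) (1 : G) 1) : E →L[ℝ] E) u) x :=
  (isInvertible_mfderiv_extChartAt_symm hx).injective
    ((mfderiv_extChartAt_symm_fderiv_mulInChartOne_left hx u).trans
      (mfderiv_invariantFieldInChart (E := E) hx _).symm)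

theorem fderiv_mulInChartOne_comm {x : E} (hx : x ∈ (extChartAt 𝓘(ℝ, E) (1 : G)).target)
    {u u' : E} (h : (mfderiv 𝓘(ℝ, E) 𝓘(ℝ, E) (extChartAt 𝓘(ℝ, E) (1 : G)).symm
        (extChartAt 𝓘(ℝ, E) (1 : G) 1) : E →L[ℝ] E) u' =
      lieGroupAd (E := E) ((extChartAt 𝓘(ℝ, E) (1 : G)).symm x) ((mfderiv 𝓘(ℝ, E) 𝓘(ℝ, E)
        (extChartAt 𝓘(ℝ, E) (1 : G)).symm (extChartAt 𝓘(ℝ, E) (1 : G) 1) : E →L[ℝ] E) u)) :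
    fderiv ℝ (mulInChartOne E G) (x, extChartAt 𝓘(ℝ, E) (1 : G) 1) (0, u) =
      fderiv ℝ (mulInChartOne E G) (extChartAt 𝓘(ℝ, E) (1 : G) 1, x) (u', 0) := by
  refine (isInvertible_mfderiv_extChartAt_symm hx).injective
    ((mfderiv_extChartAt_symm_fderiv_mulInChartOne_left hx u).trans (Eq.trans ?_
      (mfderiv_extChartAt_symm_fderiv_mulInChartOne_right hx u').symm))
  rw [h]
  exact mfderiv_mul_left_eq_mfderiv_mul_right_lieGroupAd _ _

end AdjointDerivative

/-! ### The derivative of Ad is ad -/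

section AdjointBracket

variable {E : Type*} [NormedAddCommGroup E] [NormedSpace ℝ E]
  {G : Type*} [TopologicalSpace G] [ChartedSpace E G] [Group G]

theorem mulInvariantVectorField_one (v : GroupLieAlgebra 𝓘(ℝ, E) G) :
    mulInvariantVectorField v (1 : G) = v := by
  have : (fun h : G ↦ 1 * h) = id := funext one_mul
  rw [mulInvariantVectorField, this]
  exact congrArg (fun A : E →L[ℝ] E ↦ A v) mfderiv_id

/-- The derivative at `1` of the adjoint representation of a Lie group is the adjoint
representation of its Lie algebra. -/
theorem derivAtOne_lieGroupAd [LieGroup 𝓘(ℝ, E) ∞ G] [CompleteSpace E]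
    (v w : GroupLieAlgebra 𝓘(ℝ, E) G) :
    derivAtOne (E := E) (lieGroupAd (E := E) (G := G)) w v = ⁅w, v⁆ := by
  have hn : (∞ : ℕ∞ω) ≠ 0 := by simp
  set φ := extChartAt 𝓘(ℝ, E) (1 : G) with hφ
  set e := φ 1 with hedef
  have he : e ∈ φ.target := mem_extChartAt_target (I := 𝓘(ℝ, E)) (1 : G)
  have hes : φ.symm e = 1 := extChartAt_to_inv (I := 𝓘(ℝ, E)) (1 : G)
  have hopen : φ.target ∈ 𝓝 e := (isOpen_extChartAt_target (I := 𝓘(ℝ, E)) (1 : G)).mem_nhds he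
  obtain ⟨T, hT⟩ : ∃ T : E ≃L[ℝ] E, (T : E →L[ℝ] E) = mfderiv 𝓘(ℝ, E) 𝓘(ℝ, E) φ.symm e :=
    isInvertible_mfderiv_extChartAt_symm he
  have hTu (u : E) : (mfderiv 𝓘(ℝ, E) 𝓘(ℝ, E) φ.symm e : E →L[ℝ] E) u = T u :=
    congrArg (fun A : E →L[ℝ] E ↦ A u) hT.symm
  obtain ⟨B, hBdef⟩ : ∃ B : E, B = (⁅w, v⁆ : GroupLieAlgebra 𝓘(ℝ, E) G) := ⟨_, rfl⟩
  have hbr : VectorField.lieBracket ℝ (invariantFieldInChart (E := E) (1 : G) w)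
      (invariantFieldInChart (E := E) (1 : G) v) e =
        invariantFieldInChart (E := E) (1 : G) B e := by
    rw [hBdef]; exact lieBracket_invariantFieldInChart (E := E) (G := G) he w v
  refine Eq.trans ?_ hBdef
  clear hBdef
  obtain ⟨a, rfl⟩ := T.surjective v
  obtain ⟨b, rfl⟩ := T.surjective w
  let m := mulInChartOne E G
  have hm : ContDiffAt ℝ ∞ m (e, e) :=
    contDiffAt_mulInChartOne he he (by
      rw [← hφ, hes, mul_one]; exact mem_chart_source E (1 : G))
  let D := fderiv ℝ m
  have hD : HasFDerivAt D (fderiv ℝ D (e, e)) (e, e) :=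
    ((hm.fderiv_right (m := 1) (by simpa [one_add_one_eq_two] using
      (ENat.LEInfty.out : (2 : ℕ∞ω) ≤ ∞))).differentiableAt (by simp)).hasFDerivAt
  -- `Q` is the second derivative of the multiplication at the identity. The bracket will be
  -- Q(b,0)(0,a) - Q(a,0)(0,b), the difference of the derivatives of the two invariant fields.
  set Q := fderiv ℝ D (e, e) with hQ
  have hsymm (p q : E × E) : Q p q = Q q p :=
    hm.isSymmSndFDerivAt
      (by rw [minSmoothness_of_isRCLikeNormedField]; exact ENat.LEInfty.out) p q
  have hA (u : E) : ∀ x ∈ φ.target,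
      D (x, e) (0, u) = invariantFieldInChart (E := E) (1 : G) (T u) x := by
    intro x hx
    have := fderiv_mulInChartOne_apply_zero_fst hx u
    rwa [← hφ, ← hedef, hTu] at this
  have hD1 (u : E) : HasFDerivAt (fun x ↦ D (x, e) (0, u))
      ((ContinuousLinearMap.apply ℝ E ((0, u) : E × E)).comp
        (Q.comp (ContinuousLinearMap.inl ℝ E E))) e :=
    (ContinuousLinearMap.apply ℝ E ((0, u) : E × E)).hasFDerivAt.comp e
      (HasFDerivAt.comp (f := fun x : E ↦ (x, e)) e hD (hasFDerivAt_prodMk_left e e))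
  have hfield (u : E) : fderiv ℝ (invariantFieldInChart (E := E) (1 : G) (T u)) e =
      ((ContinuousLinearMap.apply ℝ E ((0, u) : E × E)).comp
        (Q.comp (ContinuousLinearMap.inl ℝ E E))) := by
    refine ((hD1 u).congr_of_eventuallyEq ?_).fderiv
    filter_upwards [hopen] with x hx using (hA u x hx).symm
  have hfe (u : E) : invariantFieldInChart (E := E) (1 : G) (T u) e = u := by
    apply T.injective
    rw [← hTu, ← hTu]
    refine (mfderiv_invariantFieldInChart (E := E) he _).trans ?_
    rw [← hφ, hes]
    exact mulInvariantVectorField_one _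
  have hAd : HasFDerivAt (fun x ↦ lieGroupAd (E := E) (φ.symm x))
      ((derivAtOne (E := E) (lieGroupAd (E := E) (G := G))).comp (T : E →L[ℝ] E)) e := by
    have h1 : HasMFDerivAt 𝓘(ℝ, E) 𝓘(ℝ, E) φ.symm e (T : E →L[ℝ] E) := by
      rw [hT]
      exact ((contMDiffAt_extChartAt_symm he).mdifferentiableAt hn).hasMFDerivAt
    have h2 : HasMFDerivAt 𝓘(ℝ, E) 𝓘(ℝ, E →L[ℝ] E) (lieGroupAd (E := E) (G := G)) (φ.symm e)
        (derivAtOne (E := E) (lieGroupAd (E := E) (G := G))) := by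
      rw [hes]
      exact (contMDiff_lieGroupAd.contMDiffAt.mdifferentiableAt hn).hasMFDerivAt
    exact (h2.comp e h1).hasFDerivAt
  let c (x : E) : E := T.symm (lieGroupAd (E := E) (φ.symm x) (T a))
  have hc : HasFDerivAt c ((T.symm : E →L[ℝ] E).comp ((ContinuousLinearMap.apply ℝ E (T a)).comp
      ((derivAtOne (E := E) (lieGroupAd (E := E) (G := G))).comp (T : E →L[ℝ] E)))) e :=
    (T.symm : E →L[ℝ] E).hasFDerivAt.comp e
      ((ContinuousLinearMap.apply ℝ E (T a)).hasFDerivAt.comp e hAd)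
  have hce : c e = a := by
    simp only [c]
    rw [hes, lieGroupAd_one]
    simp
  -- The relation between left and right translation through Ad, in the chart. Differentiating it at
  -- `e` along `b` gives Q(b,0)(0,a) = c'(b) + Q(0,b)(a,0), and symmetry of `Q` identifies c'(b)
  -- with the bracket.
  have hB : ∀ x ∈ φ.target, D (x, e) (0, a) = D (e, x) (c x, 0) := by
    intro x hx
    refine fderiv_mulInChartOne_comm hx ?_
    rw [← hφ, ← hedef, hTu, hTu]
    exact T.apply_symm_apply _
  have hD2 : HasFDerivAt (fun x ↦ D (e, x)) (Q.comp (ContinuousLinearMap.inr ℝ E E)) e :=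
    HasFDerivAt.comp (f := fun x : E ↦ (e, x)) e hD (hasFDerivAt_prodMk_right e e)
  have hid (z : E) : D (e, e) (z, 0) = z := by
    apply T.injective
    have h := mfderiv_extChartAt_symm_fderiv_mulInChartOne_right (G := G) he z
    rw [← hφ, ← hedef, hTu, hTu, hes] at h
    have h1 : (fun h : G ↦ h * 1) = id := funext mul_one
    rw [h1] at h
    exact h.trans (congrArg (fun A : E →L[ℝ] E ↦ A (T z)) mfderiv_id)
  have hD3 := hD2.clm_apply (hc.prodMk (hasFDerivAt_const (0 : E) e))
  have hD4 := (hD1 a).unique (hD3.congr_of_eventuallyEq (by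
    filter_upwards [hopen] with x hx using hB x hx))
  have hD5 := congrArg (fun A : E →L[ℝ] E ↦ A b) hD4
  simp [hce, hid] at hD5
  rw [VectorField.lieBracket, hfield, hfield, hfe, hfe] at hbr
  have hfB := hfe (T.symm B)
  rw [T.apply_symm_apply] at hfB
  have hbr' : Q (b, 0) (0, a) - Q (a, 0) (0, b) = T.symm B := hbr.trans hfB
  apply T.symm.injective
  rw [← hbr', hD5, hsymm (a, 0) (0, b), add_sub_cancel_right]

end AdjointBracket

/-! ### From bi-invariant measure to traceless ad -/

section Unimodular

open MeasureTheory

section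

variable {E : Type*} [NormedAddCommGroup E] [NormedSpace ℝ E]
  {G : Type*} [TopologicalSpace G] [ChartedSpace E G] [Group G]

theorem derivAtOne_mul {f a : G → ℝ} (hf : MDifferentiableAt 𝓘(ℝ, E) 𝓘(ℝ, ℝ) f 1)
    (ha : MDifferentiableAt 𝓘(ℝ, E) 𝓘(ℝ, ℝ) a 1) (v : E) :
    derivAtOne (E := E) (fun h ↦ a h * f h) v =
      a 1 * derivAtOne (E := E) f v + f 1 * derivAtOne (E := E) a v :=
  congrArg (fun A : E →L[ℝ] ℝ ↦ A v) (ha.hasMFDerivAt.mul hf.hasMFDerivAt).mfderiv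

theorem derivAtOne_clm_comp {W : Type*} [NormedAddCommGroup W] [NormedSpace ℝ W] {F : G → W}
    (hF : MDifferentiableAt 𝓘(ℝ, E) 𝓘(ℝ, W) F 1) (L : W →L[ℝ] ℝ) (v : E) :
    derivAtOne (E := E) (fun h ↦ L (F h)) v = L (derivAtOne (E := E) F v) :=
  congrArg (fun A : E →L[ℝ] ℝ ↦ A v)
    (L.hasFDerivAt.hasMFDerivAt.comp 1 hF.hasMFDerivAt).mfderiv

theorem hasCompactSupport_derivAtOne_mul_right [ContinuousMul G] {f : G → ℝ}
    (hf : HasCompactSupport f) (v : E) :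
    HasCompactSupport fun g ↦ derivAtOne (E := E) (fun h ↦ f (h * g)) v := by
  refine HasCompactSupport.intro' hf.isCompact (isClosed_tsupport f) fun g hg ↦ ?_
  have h1 : (fun h ↦ f (h * g)) =ᶠ[𝓝 1] fun _ ↦ (0 : ℝ) := by
    have hc : ContinuousAt (fun h : G ↦ h * g) 1 := by fun_prop
    filter_upwards [hc.eventually_mem ((isClosed_tsupport f).isOpen_compl.mem_nhds
      (by rwa [one_mul]))] with h hh
    exact image_eq_zero_of_notMem_tsupport hh
  have h2 : derivAtOne (E := E) (fun h ↦ f (h * g)) = 0 := h1.mfderiv_eq.trans mfderiv_const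
  rw [h2]
  rfl

end

variable {E : Type*} [NormedAddCommGroup E] [NormedSpace ℝ E] [FiniteDimensional ℝ E]
  {G : Type*} [TopologicalSpace G] [T2Space G] [SecondCountableTopology G] [ChartedSpace E G]
  [Group G] [LieGroup 𝓘(ℝ, E) ∞ G] [MeasurableSpace G] [BorelSpace G]

/-- The sum is the value at 1 of `ψ`, the divergence of the coefficients of the left invariant field
of `v` in the right invariant frame. Integration by parts shows that `ψ` is orthogonal to all test
functions. -/
theorem sum_coord_derivAtOne_lieGroupAd_eq_zero (μ : Measure G) [μ.IsHaarMeasure]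
    [μ.IsMulRightInvariant] {ι : Type*} [Fintype ι] (b : Module.Basis ι ℝ E) (v : E) :
    ∑ i, b.coord i (derivAtOne (E := E) (lieGroupAd (E := E) (G := G)) (b i) v) = 0 := by
  have : IsTopologicalGroup G := topologicalGroup_of_lieGroup 𝓘(ℝ, E) ∞
  have : LocallyCompactSpace G := Manifold.locallyCompact_of_finiteDimensional 𝓘(ℝ, E)
  have : SigmaCompactSpace G := inferInstance
  have hn : (∞ : ℕ∞ω) ≠ 0 := by simp
  let L (i) : (E →L[ℝ] E) →L[ℝ] ℝ :=
    (LinearMap.toContinuousLinearMap (b.coord i)).comp (ContinuousLinearMap.apply ℝ E v)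
  let a (i) (g : G) : ℝ := L i (lieGroupAd (E := E) g)
  have ha (i) : ContMDiff 𝓘(ℝ, E) 𝓘(ℝ, ℝ) ∞ (a i) :=
    (L i).contMDiff.comp contMDiff_lieGroupAd
  let ψ (g : G) : ℝ := ∑ i, derivAtOne (E := E) (fun h ↦ a i (h * g)) (b i)
  have hψ : Continuous ψ :=
    continuous_finsetSum _ fun i _ ↦ continuous_derivAtOne_mul_right (ha i) (b i)
  have hint (f : G → ℝ) (hf : ContMDiff 𝓘(ℝ, E) 𝓘(ℝ, ℝ) ∞ f) (hfc : HasCompactSupport f) :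
      ∫ g, f g • ψ g ∂μ = 0 := by
    have haf (i) : ContMDiff 𝓘(ℝ, E) 𝓘(ℝ, ℝ) ∞ fun g ↦ a i g * f g := (ha i).mul hf
    have hafc (i) : HasCompactSupport fun g ↦ a i g * f g := hfc.mul_left
    -- Leibniz rule for R_i(a_i f), summed over i, with ∑ a_i R_i f rewritten as the left invariant
    -- derivative of `f`. Both resulting terms integrate to zero.
    have key (g : G) : f g • ψ g =
        ∑ i, derivAtOne (E := E) (fun h ↦ a i (h * g) * f (h * g)) (b i) -
          derivAtOne (E := E) (fun h ↦ f (g * h)) v := by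
      have hfg : MDifferentiableAt 𝓘(ℝ, E) 𝓘(ℝ, ℝ) (fun h ↦ f (h * g)) 1 :=
        (hf.comp contMDiff_mul_right).contMDiffAt.mdifferentiableAt hn
      have hag (i) : MDifferentiableAt 𝓘(ℝ, E) 𝓘(ℝ, ℝ) (fun h ↦ a i (h * g)) 1 :=
        ((ha i).comp contMDiff_mul_right).contMDiffAt.mdifferentiableAt hn
      have h1 : derivAtOne (E := E) (fun h ↦ f (g * h)) v =
          ∑ i, a i g * derivAtOne (E := E) (fun h ↦ f (h * g)) (b i) := by
        rw [derivAtOne_mul_left_eq hf]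
        conv_lhs => rw [← b.sum_repr (lieGroupAd (E := E) g v), map_sum]
        refine Finset.sum_congr rfl fun i _ ↦ ?_
        rw [map_smul, smul_eq_mul]
        rfl
      rw [h1, smul_eq_mul, Finset.mul_sum, ← Finset.sum_sub_distrib]
      refine Finset.sum_congr rfl fun i _ ↦ ?_
      rw [derivAtOne_mul hfg (hag i), one_mul]
      ring
    have hi (i) : Integrable
        (fun g ↦ derivAtOne (E := E) (fun h ↦ a i (h * g) * f (h * g)) (b i)) μ :=
      (continuous_derivAtOne_mul_right (haf i) (b i)).integrable_of_hasCompactSupport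
        (hasCompactSupport_derivAtOne_mul_right (hafc i) (b i))
    have hf' : Integrable (fun g ↦ f g • ψ g) μ :=
      (hf.continuous.smul hψ).integrable_of_hasCompactSupport hfc.smul_right
    have hfv : Integrable (fun g ↦ derivAtOne (E := E) (fun h ↦ f (g * h)) v) μ := by
      refine ((integrable_finsetSum Finset.univ fun i _ ↦ hi i).sub hf').congr
        (Filter.Eventually.of_forall fun g ↦ ?_)
      simp only [Pi.sub_apply, key g]
      ring
    simp only [key]
    rw [integral_sub (integrable_finsetSum Finset.univ fun i _ ↦ hi i) hfv,
      integral_finsetSum _ fun i _ ↦ hi i,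
      integral_derivAtOne_mul_left_eq_zero μ hf hfc, sub_zero]
    exact Finset.sum_eq_zero fun i _ ↦
      integral_derivAtOne_mul_right_eq_zero μ (haf i) (hafc i) (b i)
  -- The fundamental lemma of the calculus of variations; continuity and full support of Haar
  -- measure then give the value at the single point 1.
  have hae : ψ =ᵐ[μ] fun _ ↦ 0 :=
    ae_eq_zero_of_integral_contMDiff_smul_eq_zero 𝓘(ℝ, E) hψ.locallyIntegrable hint
  have hψ1 : ψ 1 = 0 := congrFun ((hψ.ae_eq_iff_eq μ continuous_const).1 hae) 1
  refine Eq.trans (Finset.sum_congr rfl fun i _ ↦ ?_) hψ1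
  simp only [mul_one]
  exact (derivAtOne_clm_comp (contMDiff_lieGroupAd.contMDiffAt.mdifferentiableAt hn)
    (L i) (b i)).symm

/-- A Lie group with a bi-invariant Haar measure has a unimodular Lie algebra. -/
theorem isUnimodularLieAlgebra_of_isMulRightInvariant (μ : Measure G) [μ.IsHaarMeasure]
    [μ.IsMulRightInvariant] : IsUnimodularLieAlgebra (GroupLieAlgebra 𝓘(ℝ, E) G) := by
  intro v
  let b : Module.Basis _ ℝ (GroupLieAlgebra 𝓘(ℝ, E) G) := Module.finBasis ℝ E
  -- The sign is needed because the divergence involves [b_i, v] while the trace of ad v involves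
  -- [v, b_i].
  rw [LinearMap.trace_eq_matrix_trace ℝ b, Matrix.trace, ← neg_eq_zero, ← Finset.sum_neg_distrib]
  refine Eq.trans (Finset.sum_congr rfl fun i _ ↦ ?_)
    (sum_coord_derivAtOne_lieGroupAd_eq_zero μ (Module.finBasis ℝ E) v)
  rw [Matrix.diag_apply, LinearMap.toMatrix_apply]
  refine Eq.trans ?_ (congrArg (b.coord i) (derivAtOne_lieGroupAd v (b i))).symm
  rw [← lie_skew, map_neg]
  rfl

/-- A connected Lie group with a cocompact discrete subgroup has a unimodular Lie algebra. -/
theorem LeftQuotient.isUnimodularLieAlgebra_of_compactSpace {E : Type*} [NormedAddCommGroup E]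
    [NormedSpace ℝ E] [FiniteDimensional ℝ E] {G : Type*} [TopologicalSpace G] [T2Space G]
    [ChartedSpace E G] [Group G] [LieGroup 𝓘(ℝ, E) ∞ G] [PreconnectedSpace G]
    (Γ : Subgroup G) [DiscreteTopology Γ] [CompactSpace (LeftQuotient Γ)] :
    IsUnimodularLieAlgebra (GroupLieAlgebra 𝓘(ℝ, E) G) := by
  have : IsTopologicalGroup G := topologicalGroup_of_lieGroup 𝓘(ℝ, E) ∞
  have : LocallyCompactSpace G := Manifold.locallyCompact_of_finiteDimensional 𝓘(ℝ, E)
  -- Connectedness enters here: σ-compactness gives second countability, which makes the discrete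
  -- subgroup countable.
  have : SigmaCompactSpace G := IsTopologicalGroup.sigmaCompactSpace_of_preconnectedSpace G
  have : SecondCountableTopology G := ChartedSpace.secondCountable_of_sigmaCompact E G
  have : Countable Γ := TopologicalSpace.separableSpace_iff_countable.1 inferInstance
  borelize G
  have := LeftQuotient.isMulRightInvariant_of_compactSpace (Measure.haar : Measure G) Γ
    (LeftQuotient.isLocalHomeomorph_mk E Γ)
  exact isUnimodularLieAlgebra_of_isMulRightInvariant Measure.haar

end Unimodular
theorem mainTheorem7 :
    -- Lie algebras with an abelian complex structure
    (∀ (n : ℕ) (𝔤 : Type*) [LieRing 𝔤] [LieAlgebra ℝ 𝔤] [FiniteDimensional ℝ 𝔤]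
      (J : 𝔤 →ₗ[ℝ] 𝔤),
      Module.finrank ℝ 𝔤 = 2 * n → IsAbelianComplexStructure J →
      ((∃ σ : 𝔤 [⋀^Fin n]→ₗ[ℝ] ℂ,
          σ ≠ 0 ∧ IsTypeKZero J σ ∧ ∀ x, lieFormDifferential σ x = 0) ↔
        IsUnimodularLieAlgebra 𝔤)) ∧
    -- complex solvmanifolds `Γ\G` with an abelian complex structure
    (∀ (n : ℕ) (E : Type*) [NormedAddCommGroup E] [NormedSpace ℝ E] [FiniteDimensional ℝ E]
      (G : Type*) [TopologicalSpace G] [T2Space G] [ChartedSpace E G] [Group G]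
      [LieGroup 𝓘(ℝ, E) ∞ G] [SimplyConnectedSpace G] [Group.IsSolvable G]
      (Γ : Subgroup G) [DiscreteTopology Γ] [CompactSpace (LeftQuotient Γ)]
      (J : GroupLieAlgebra 𝓘(ℝ, E) G →ₗ[ℝ] GroupLieAlgebra 𝓘(ℝ, E) G)
      (JM : ∀ x : LeftQuotient Γ, TangentSpace 𝓘(ℝ, E) x →L[ℝ] TangentSpace 𝓘(ℝ, E) x),
      Module.finrank ℝ E = 2 * n → IsAbelianComplexStructure J →
      LeftQuotient.IsInducedComplexStructure Γ J JM →
      HasTrivialCanonicalBundle JM n) := by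
  refine ⟨fun n 𝔤 _ _ _ J hn hJ ↦ exists_closed_form_iff_isUnimodularLieAlgebra J hn hJ, ?_⟩
  intro n E _ _ _ G _ _ _ _ _ _ _ Γ _ _ J JM hn hJ hJM
  exact LeftQuotient.hasTrivialCanonicalBundle_of_isUnimodular hn hJ hJM
    (LeftQuotient.isUnimodularLieAlgebra_of_compactSpace Γ)
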